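/- All graphs are finite, simple and undirected. A path is a sequence of distinct vertices in which consecutive vertices are adjacent; it is Hamiltonian if it contains all vertices. $kK_1$ is the edgeless graph on $k$ vertices, and a graph is $kK_1$-free if it has no induced subgraph isomorphic to $kK_1$. $G[A]$ is the subgraph of $G$ induced by $A\subseteq V(G)$, $G-A=G[V(G)\setminus A]$, and $c(G)$ is the number of connected components of $G$. A vertex cut of $G$ is a set $A\subset V(G)$ such that $G-A$ is disconnected; a minimum vertex cut is a vertex cut of smallest size; an articulation point is a vertex $x$ such that $\{x\}$ is a vertex cut. The vertex connectivity of $G$ is the size of a minimum vertex cut, or $|V(G)|-1$ if $G$ is complete, and $G$ is $s$-connected if its vertex connectivity is at least $s$. **Theorem.** Let $G$ be a connected $5K_1$-free graph. Then $G$ has a Hamiltonian path if and only if all of the following conditions are satisfied. (a) For every articulation point $x$ of $G$, $c(G-\{x\})\le 2$. (b) There are no three articulation points of $G$ inducing a triangle in $G$. (c) If $G$ is not $2$-connected, and $x$ is an articulation point of $G$ such that $G-\{x\}$ has exactly two components, one of which has a vertex set $Q_1$ that is a clique in $G$, while the other has a vertex set $Q_2$ such that $G[Q_2]$ is $4K_1$-free,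 then there is a vertex $u\in Q_2$ adjacent to $x$ such that $G[Q_2]$ has a Hamiltonian path starting in $u$. (d) If $G$ is $2$-connected but not $3$-connected, then for every minimum vertex cut $\{x,y\}$ of $G$ (with $x\neq y$), $c(G-\{x,y\})\le 3$. -/

import Mathlib

open scoped Classical in
/-- `G` has a Hamiltonian path: a path through every vertex exactly once. -/
def HasHamiltonianPath {V : Type*} (G : SimpleGraph V) : Prop :=
  ∃ (u v : V) (p : G.Walk u v), p.IsHamiltonian

open scoped Classical in
/-- `G` has a Hamiltonian path starting in `u`. -/
def HasHamiltonianPathFrom {V : Type*} (G : SimpleGraph V) (u : V) : Prop :=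
  ∃ (v : V) (p : G.Walk u v), p.IsHamiltonian

/-- `G` is `k K₁`-free: no induced subgraph of `G` is isomorphic to the edgeless graph on
`k` vertices. -/
def IsEdgelessFree {V : Type*} (k : ℕ) (G : SimpleGraph V) : Prop :=
  ¬ (⊥ : SimpleGraph (Fin k)).IsIndContained G

/-- The graph `G - A`, obtained from `G` by deleting the vertices in `A`. -/
abbrev deleteVerts {V : Type*} (G : SimpleGraph V) (A : Set V) : SimpleGraph ↥(Aᶜ) :=
  G.induce Aᶜ

/-- `c(G)`, the number of connected components. -/
noncomputable def numComponents {V : Type*} (G : SimpleGraph V) : ℕ :=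
  Nat.card G.ConnectedComponent

/-- The vertex sets, in `G`, of the connected components of `G - A`. -/
def componentsOfDelete {V : Type*} (G : SimpleGraph V) (A : Set V) : Set (Set V) :=
  {Q | ∃ C : (deleteVerts G A).ConnectedComponent, Q = Subtype.val '' C.supp}

/-- `A` is a vertex cut: `G - A` is disconnected, i.e. two of its vertices are not joined by a
path (so `G - A` without vertices does not count as disconnected). -/
def IsVertexCut {V : Type*} (G : SimpleGraph V) (A : Set V) : Prop :=
  ¬ (deleteVerts G A).Preconnected

/-- An articulation point is a vertex cut of size one. -/
def IsArticulationPoint {V : Type*} (G : SimpleGraph V) (x : V) : Prop :=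
  IsVertexCut G {x}

/-- `A` is a minimum vertex cut: a vertex cut of the least possible size. -/
def IsMinimumVertexCut {V : Type*} (G : SimpleGraph V) (A : Set V) : Prop :=
  IsVertexCut G A ∧ ∀ B : Set V, IsVertexCut G B → A.ncard ≤ B.ncard

open scoped Classical in
/-- The vertex connectivity of a finite graph: the order of a minimum vertex cut, or `|V| - 1` if
the graph is complete. -/
noncomputable def vertexConnectivity {V : Type*} (G : SimpleGraph V) : ℕ :=
  if G = ⊤ then Nat.card V - 1 else sInf {n | ∃ A : Set V, IsVertexCut G A ∧ A.ncard = n}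

/-- `G` is `s`-connected: its vertex connectivity is at least `s`. -/
def IsVertexConnected {V : Type*} (s : ℕ) (G : SimpleGraph V) : Prop :=
  s ≤ vertexConnectivity G

/-!
A Hamiltonian path meets at most `|X| + 1` components of `G - X`, and it is divided by each cut
vertex `x` into Hamiltonian paths of the two sides of `x`, with no edge jumping over `x`; so the
four conditions are necessary (`numComponents_le_of_span`, `not_triangle_of_span`,
`exists_span_side_of_span`).

For sufficiency, the basic tool is a path whose vertex set cannot be enlarged, together with a
component `H` of the rest of the graph. The successors on the path of the vertices with a
neighbour in `H`, the first vertex of the path and a vertex of `H` form an independent set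
(`MaxPath.exists_indep_head`), because an edge among them could be used to reroute the path through
`H`. As independent sets have at most four vertices, `H` has at most two outer neighbours.

If there is a cut vertex `x`, it has two sides. If one of them is a clique, the other has
independence number at most three, and the third condition gives a path. Otherwise both sides have
independence number two. By `exists_span_or_cliquePair` such a side has Hamiltonian paths from
every vertex or consists of two cliques meeting in a cut vertex; in the second case only a third
component or a triangle of cut vertices can prevent a Hamiltonian path from starting in a neighbour
of `x` (`exists_span_of_adj_cutVertex`).

If there is no cut vertex, `H` is a clique with exactly two outer neighbours `x` and `y`, and there
is a path that runs through `x`, `H`, `y` and has both ends elsewhere. If such a path has a maximal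
vertex set, then counting successors in both directions shows that a component `H'` of the rest is
again a clique with two outer neighbours, one being `x` or its predecessor `z`, the other `y` or its
successor `w` (`span_of_maximal_excursion`). What remains after deleting `H`, `H'` and their outer
neighbours has independence number at most two. In each of the cases a Hamiltonian path is put
together from these pieces (`span_of_two_attached`, `span_of_cliques_common`,
`span_of_cliques_disjoint`); the condition on cuts with two vertices excludes the case that too many
of them are attached to the same two vertices.
-/

/-! ### Paths spanning a vertex set, connected sets, independence numbers -/

/-- `Span G S u v`: the subgraph of `G` induced by `S` has a Hamiltonian path from `u` to `v`,
given as the list of its vertices. -/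
def Span {V : Type*} (G : SimpleGraph V) (S : Set V) (u v : V) : Prop :=
  ∃ l : List V, l.IsChain G.Adj ∧ l.Nodup ∧ l.head? = some u ∧ l.getLast? = some v ∧
    ∀ x, x ∈ l ↔ x ∈ S

/-- `ConnOn G S`: the subgraph of `G` induced by `S` is connected (or `S` is empty), in the form
that a nonempty subset of `S` with no edge to the rest of `S` is all of `S`. -/
def ConnOn {V : Type*} (G : SimpleGraph V) (S : Set V) : Prop :=
  ∀ T ⊆ S, T.Nonempty → (∀ u ∈ T, ∀ v ∈ S, G.Adj u v → v ∈ T) → S ⊆ T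

/-- The independence number of the subgraph of `G` induced by `S` is at most `k`. -/
def AlphaLE {V : Type*} (G : SimpleGraph V) (S : Set V) (k : ℕ) : Prop :=
  ∀ I : Finset V, (I : Set V) ⊆ S → G.IsIndepSet (I : Set V) → I.card ≤ k

namespace Span

variable {V : Type*} {G : SimpleGraph V} {S T : Set V} {u v u' v' : V}

lemma singleton (G : SimpleGraph V) (u : V) : Span G {u} u u :=
  ⟨[u], by simp, by simp, by simp, by simp, by simp⟩

lemma left_mem (h : Span G S u v) : u ∈ S := by
  obtain ⟨l, -, -, h1, -, h3⟩ := h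
  exact (h3 u).1 (List.mem_of_head? h1)

lemma right_mem (h : Span G S u v) : v ∈ S := by
  obtain ⟨l, -, -, -, h1, h3⟩ := h
  exact (h3 v).1 (List.mem_of_getLast? h1)

lemma symm (h : Span G S u v) : Span G S v u := by
  obtain ⟨l, h1, h2, h3, h4, h5⟩ := h
  refine ⟨l.reverse, ?_, by simpa using h2, by simpa using h4, by simpa using h3, by simpa using h5⟩
  rw [List.isChain_reverse]
  exact h1.imp fun a b h => h.symm

lemma append (h : Span G S u v) (h' : Span G T u' v') (hd : Disjoint S T) (ha : G.Adj v u') :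
    Span G (S ∪ T) u v' := by
  obtain ⟨l, h1, h2, h3, h4, h5⟩ := h
  obtain ⟨l', h1', h2', h3', h4', h5'⟩ := h'
  refine ⟨l ++ l', ?_, ?_, ?_, ?_, ?_⟩
  · rw [List.isChain_append]
    refine ⟨h1, h1', ?_⟩
    intro x hx y hy
    rw [h4] at hx; rw [h3'] at hy
    simp only [Option.mem_def, Option.some.injEq] at hx hy
    exact hx ▸ hy ▸ ha
  · rw [List.nodup_append]
    refine ⟨h2, h2', ?_⟩
    rintro a hal b hb rfl
    exact Set.disjoint_left.1 hd ((h5 a).1 hal) ((h5' a).1 hb)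
  · simp [List.head?_append, h3]
  · simp [List.getLast?_append, h4']
  · intro x; simp [h5, h5']

/-- Appending with the vertex set of the result stated freely. -/
lemma append' {U : Set V} (h : Span G S u v) (h' : Span G T u' v') (hd : ∀ a ∈ S, a ∉ T)
    (ha : G.Adj v u') (hU : ∀ a, a ∈ U ↔ a ∈ S ∨ a ∈ T) : Span G U u v' := by
  have : U = S ∪ T := Set.ext hU
  exact this ▸ h.append h' (Set.disjoint_left.2 hd) ha

lemma congr_set (h : Span G S u v) (hT : ∀ a, a ∈ T ↔ a ∈ S) : Span G T u v :=
  (Set.ext hT : T = S) ▸ h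

end Span

section

variable {V : Type*} {G : SimpleGraph V} {S T K : Set V} {u v : V}

lemma span_of_list {l : List V} (h1 : l.IsChain G.Adj) (h2 : l.Nodup) (h3 : l.head? = some u)
    (h4 : l.getLast? = some v) : Span G {x | x ∈ l} u v :=
  ⟨l, h1, h2, h3, h4, fun _ => Iff.rfl⟩

/-- In a connected vertex set any two vertices are joined by a path inside the set. -/
lemma ConnOn.exists_span (hS : ConnOn G S) (hu : u ∈ S) (hv : v ∈ S) :
    ∃ T ⊆ S, Span G T u v := by
  refine hS {w | ∃ T ⊆ S, Span G T u w} ?_ ?_ ?_ hv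
  · rintro w ⟨T, hT, h⟩
    exact hT h.right_mem
  · exact ⟨u, {u}, by simpa using hu, Span.singleton G u⟩
  · rintro w ⟨T, hT, h⟩ w' hw' ha
    by_cases hw : w' ∈ T
    · obtain ⟨l, h1, h2, h3, h4, h5⟩ := h
      obtain ⟨A, B, rfl⟩ := List.append_of_mem ((h5 w').2 hw)
      refine ⟨{x | x ∈ A ++ [w']}, ?_, ?_⟩
      · intro x hx
        apply hT
        rw [← h5]
        simp only [Set.mem_ofPred_eq, List.mem_append, List.mem_singleton] at hx
        simp only [List.mem_append, List.mem_cons]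
        tauto
      · have e : A ++ w' :: B = (A ++ [w']) ++ B := by simp
        rw [e] at h1 h2 h3
        refine span_of_list h1.left_of_append (List.nodup_append.1 h2).1 ?_ (by simp)
        rw [List.head?_append] at h3
        cases A <;> simpa using h3
    · refine ⟨T ∪ {w'}, Set.union_subset hT (by simpa using hw'), ?_⟩
      exact h.append (Span.singleton G w') (by simpa using hw) ha

/-- Every vertex of `S` lies in a connected component of the subgraph induced by `S`: in the
smallest set containing it that has no edge to the rest of `S`. -/
lemma exists_component [Finite V] (G : SimpleGraph V) (hv : v ∈ S) :
    ∃ K ⊆ S, v ∈ K ∧ ConnOn G K ∧ ∀ a ∈ K, ∀ b ∈ S, G.Adj a b → b ∈ K := by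
  let F : Set (Set V) := {K | K ⊆ S ∧ v ∈ K ∧ ∀ a ∈ K, ∀ b ∈ S, G.Adj a b → b ∈ K}
  obtain ⟨K, hK⟩ := F.toFinite.exists_minimal ⟨S, subset_rfl, hv, fun _ _ b hb _ => hb⟩
  obtain ⟨⟨h1, h2, h3⟩, hmin⟩ := hK
  refine ⟨K, h1, h2, ?_, h3⟩
  intro T hT hne hcl
  by_cases hvT : v ∈ T
  · refine hmin ⟨hT.trans h1, hvT, fun a ha b hb hab => ?_⟩ hT
    exact hcl a ha b (h3 a (hT ha) b hb hab) hab
  · have : K ≤ K \ T := by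
      refine hmin ⟨Set.sdiff_subset.trans h1, ⟨h2, hvT⟩, fun a ha b hb hab => ?_⟩ Set.sdiff_subset
      exact ⟨h3 a ha.1 b hb hab, fun hbT => ha.2 (hcl b hbT a ha.1 hab.symm)⟩
    obtain ⟨t, ht⟩ := hne
    exact absurd ht (this (hT ht)).2

/-- A disconnected vertex set splits into two nonempty parts with no edge in between. -/
lemma exists_split (h : ¬ ConnOn G S) : ∃ A B : Set V, A.Nonempty ∧ B.Nonempty ∧
    (∀ a, a ∈ S ↔ a ∈ A ∨ a ∈ B) ∧ (∀ a ∈ A, a ∉ B) ∧ ∀ a ∈ A, ∀ b ∈ B, ¬ G.Adj a b := by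
  unfold ConnOn at h
  push Not at h
  obtain ⟨T, hT, hne, hcl, hn⟩ := h
  obtain ⟨b, hb, hbT⟩ := Set.not_subset.1 hn
  refine ⟨T, S \ T, hne, ⟨b, hb, hbT⟩, fun a => ?_, fun a ha h => h.2 ha,
    fun a ha b hb hab => hb.2 (hcl a ha b hb.1 hab)⟩
  by_cases a ∈ T
  · simp_all [hT _]
  · simp_all

/-- A proper nonempty subset of a connected set sends an edge to the rest of the set. -/
lemma ConnOn.exists_adj (hS : ConnOn G S) (hT : T ⊆ S) (hne : T.Nonempty) (hv : v ∈ S)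
    (hvT : v ∉ T) : ∃ a ∈ T, ∃ b ∈ S, b ∉ T ∧ G.Adj a b := by
  by_contra! h
  exact hvT (hS T hT hne (fun a ha b hb hab => by_contra fun hbT => h a ha b hb hbT hab) hv)

lemma alphaLE_one_iff : AlphaLE G S 1 ↔ G.IsClique S := by
  classical
  constructor
  · intro h a ha b hb hab
    by_contra hn
    have := h {a, b} (by simp [Set.insert_subset_iff, ha, hb]) (by
      simp only [Finset.coe_insert, Finset.coe_singleton]
      intro x hx y hy hxy
      simp only [Set.mem_insert_iff, Set.mem_singleton_iff] at hx hy
      rcases hx with rfl | rfl <;> rcases hy with rfl | rfl <;> simp_all [G.adj_comm])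
    rw [Finset.card_pair hab] at this
    omega
  · intro h I hI hi
    rw [Finset.card_le_one]
    intro a ha b hb
    by_contra hab
    exact hi ha hb hab (h (hI ha) (hI hb) hab)

/-- Independent sets in two parts without edges in between unite to an independent set. -/
lemma exists_indep_union {A B : Set V} (hd : ∀ a ∈ A, a ∉ B) (hn : ∀ a ∈ A, ∀ b ∈ B, ¬ G.Adj a b)
    {I J : Finset V} (hI : (I : Set V) ⊆ A) (hJ : (J : Set V) ⊆ B)
    (hi : G.IsIndepSet (I : Set V)) (hj : G.IsIndepSet (J : Set V)) :
    ∃ K : Finset V, (K : Set V) ⊆ A ∪ B ∧ G.IsIndepSet (K : Set V) ∧ K.card = I.card + J.card := by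
  classical
  refine ⟨I ∪ J, by
    rw [Finset.coe_union]; exact Set.union_subset_union hI hJ, ?_, ?_⟩
  · intro x hx y hy hxy
    simp only [Finset.coe_union, Set.mem_union] at hx hy
    rcases hx with hx | hx <;> rcases hy with hy | hy
    · exact hi hx hy hxy
    · exact hn x (hI hx) y (hJ hy)
    · exact fun h => hn y (hI hy) x (hJ hx) h.symm
    · exact hj hx hy hxy
  · refine Finset.card_union_of_disjoint (Finset.disjoint_left.2 fun a ha hb => ?_)
    exact hd a (hI ha) (hJ hb)

/-- If `A` and `B` have no edges in between, `α(A) + α(B)` is at most the independence number of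
`A ∪ B`. -/
lemma AlphaLE.of_not_alphaLE {A B : Set V} {k i j : ℕ} (h : AlphaLE G S k) (hA : A ⊆ S) (hB : B ⊆ S)
    (hd : ∀ a ∈ A, a ∉ B) (hn : ∀ a ∈ A, ∀ b ∈ B, ¬ G.Adj a b) (hAi : ¬ AlphaLE G A i)
    (hij : k ≤ i + j + 1) : AlphaLE G B j := by
  unfold AlphaLE at hAi
  push Not at hAi
  obtain ⟨I, hI, hi, hc⟩ := hAi
  intro J hJ hj
  obtain ⟨K, hK, hk, hcard⟩ := exists_indep_union hd hn hI hJ hi hj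
  have := h K (hK.trans (Set.union_subset hA hB)) hk
  omega

lemma not_alphaLE_zero (hne : S.Nonempty) : ¬ AlphaLE G S 0 := by
  obtain ⟨a, ha⟩ := hne
  intro h
  have := h {a} (by simpa using ha) (by simp)
  simp at this

lemma AlphaLE.adj_of_triple {a b c : V} (h : AlphaLE G S 2) (ha : a ∈ S) (hb : b ∈ S) (hc : c ∈ S)
    (hab : a ≠ b) (hac : a ≠ c) (hbc : b ≠ c) (h1 : ¬ G.Adj a b) (h2 : ¬ G.Adj a c) :
    G.Adj b c := by
  classical
  by_contra h3
  have := h {a, b, c} (by simp [Set.insert_subset_iff, ha, hb, hc]) (by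
    intro x hx y hy hxy
    simp only [Finset.coe_insert, Finset.coe_singleton, Set.mem_insert_iff,
      Set.mem_singleton_iff] at hx hy
    have h4 := G.symm
    rcases hx with rfl | rfl | rfl <;> rcases hy with rfl | rfl | rfl <;>
      first | exact absurd rfl hxy | assumption | exact fun h => absurd h.symm (by assumption))
  rw [Finset.card_eq_three.2 ⟨a, b, c, hab, hac, hbc, rfl⟩] at this
  omega

lemma span_of_isClique [Finite V] (hK : G.IsClique S) (hu : u ∈ S) (hv : v ∈ S) (huv : u ≠ v) :
    Span G S u v := by
  classical
  have hfin : (S \ {u, v}).Finite := Set.toFinite _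
  refine ⟨u :: (hfin.toFinset.toList ++ [v]), ?_, ?_, by simp, by
    rw [← List.cons_append, List.getLast?_append]; simp, ?_⟩
  · have hnd : (u :: (hfin.toFinset.toList ++ [v])).Nodup := by
      simp [List.nodup_append, Finset.nodup_toList, huv]
    have hp : (u :: (hfin.toFinset.toList ++ [v])).Pairwise G.Adj := by
      refine hnd.imp_of_mem ?_
      intro a b ha hb hab
      apply hK _ _ hab
      · simp at ha; grind
      · simp at hb; grind
    exact hp.isChain
  · simp [List.nodup_append, Finset.nodup_toList, huv]
  · intro x
    simp
    grind

lemma exists_span_of_isClique [Finite V] (hK : G.IsClique S) (hu : u ∈ S) :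
    ∃ v, Span G S u v := by
  by_cases h : ∃ v ∈ S, u ≠ v
  · obtain ⟨v, hv, huv⟩ := h
    exact ⟨v, span_of_isClique hK hu hv huv⟩
  · push Not at h
    refine ⟨u, (Span.singleton G u).congr_set fun a => ?_⟩
    simp only [Set.mem_singleton_iff]
    exact ⟨fun ha => (h a ha).symm, fun ha => ha ▸ hu⟩

end

/-! ### Exchange arguments on a maximal path -/

/-- `n'` comes immediately after `n` in the list `l`. -/
def Consec {V : Type*} (l : List V) (n n' : V) : Prop :=
  ∃ A B : List V, l = A ++ n :: n' :: B

/-- The vertex `n` has a neighbour in `H`. -/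
def Touches {V : Type*} (G : SimpleGraph V) (n : V) (H : Set V) : Prop :=
  ∃ h ∈ H, G.Adj n h

/-- The list `l` is a path from `a` to `b` avoiding the connected set `H`, and no path from `a` to
`b` extends the vertex set of `l` by vertices of `H`. -/
structure MaxPath {V : Type*} (G : SimpleGraph V) (l : List V) (a b : V) (H : Set V) : Prop where
  chain : l.IsChain G.Adj
  nodup : l.Nodup
  head : l.head? = some a
  last : l.getLast? = some b
  conn : ConnOn G H
  disj : ∀ x ∈ H, x ∉ l
  max : ∀ T : Set V, {x | x ∈ l} ⊆ T → T ⊆ {x | x ∈ l} ∪ H → Span G T a b → T ⊆ {x | x ∈ l}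

section

variable {V : Type*} {G : SimpleGraph V} {l : List V} {a b n m n' m' : V} {H : Set V}

lemma Consec.reverse (h : Consec l n n') : Consec l.reverse n' n := by
  obtain ⟨A, B, rfl⟩ := h
  exact ⟨B.reverse, A.reverse, by simp⟩

lemma Consec.right_mem (h : Consec l n n') : n' ∈ l := by
  obtain ⟨A, B, rfl⟩ := h; simp

lemma Consec.left_unique (hl : l.Nodup) (h : Consec l n n') (h' : Consec l m n') : n = m := by
  obtain ⟨A, B, rfl⟩ := h
  obtain ⟨A', B', h'⟩ := h'
  have e : (A ++ [n]) ++ n' :: B = (A' ++ [m]) ++ n' :: B' := by simpa using h'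
  have h1 : n' ∉ A ++ [n] := by
    intro hx
    have : (A ++ [n] ++ n' :: B).Nodup := by simpa using hl
    exact (List.nodup_append.1 this).2.2 _ hx n' (by simp) rfl
  have h2 : n' ∉ A' ++ [m] := by
    intro hx
    have : (A' ++ [m] ++ n' :: B').Nodup := by rw [← e]; simpa using hl
    exact (List.nodup_append.1 this).2.2 _ hx n' (by simp) rfl
  rcases List.append_eq_append_iff.1 e with ⟨D, h3, h4⟩ | ⟨D, h3, h4⟩
  · cases D with
    | nil => simp at h3; exact h3.2.symm
    | cons d D => simp at h4; rw [h3] at h2; simp [h4.1] at h2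
  · cases D with
    | nil => simp at h3; exact h3.2
    | cons d D => simp at h4; rw [h3] at h1; simp [h4.1] at h1

lemma exists_consec (hn : n ∈ l) (hb : l.getLast? = some b) (hnb : n ≠ b) :
    ∃ n', Consec l n n' := by
  obtain ⟨A, B, rfl⟩ := List.append_of_mem hn
  cases B with
  | nil => simp at hb; exact absurd hb hnb
  | cons n' B => exact ⟨n', A, B, rfl⟩

lemma Consec.ne_head (hl : l.Nodup) (ha : l.head? = some a) (h : Consec l n n') : n' ≠ a := by
  rintro rfl
  obtain ⟨A, B, rfl⟩ := h
  cases A <;> simp_all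

lemma Consec.adj (hl : l.IsChain G.Adj) (h : Consec l n n') : G.Adj n n' := by
  obtain ⟨A, B, rfl⟩ := h
  exact (List.isChain_cons_cons.1 hl.right_of_append).1

/-- Two different steps `n → n'` and `m → m'` of a path cut it into three paths. -/
lemma exists_three_parts (hn : Consec l n n') (hm : Consec l m m') (hnm : n ≠ m) :
    (∃ A D B, l = A ++ (D ++ B) ∧ A.getLast? = some n ∧ D.head? = some n' ∧ D.getLast? = some m ∧
      B.head? = some m') ∨
    (∃ A D B, l = A ++ (D ++ B) ∧ A.getLast? = some m ∧ D.head? = some m' ∧ D.getLast? = some n ∧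
      B.head? = some n') := by
  obtain ⟨A, B, rfl⟩ := hn
  obtain ⟨A', B', e⟩ := hm
  have e : (A ++ [n]) ++ n' :: B = (A' ++ [m]) ++ m' :: B' := by simpa using e
  rcases List.append_eq_append_iff.1 e with ⟨D, h3, h4⟩ | ⟨D, h3, h4⟩
  · left
    refine ⟨A ++ [n], D, m' :: B', by rw [← h4]; simp, by simp, ?_, ?_, by simp⟩
    · cases D with
      | nil => simp at h3; exact absurd h3.2.symm hnm
      | cons d D => simp at h4; simp [h4.1]
    · rcases D.eq_nil_or_concat with rfl | ⟨D, d, rfl⟩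
      · simp at h3; exact absurd h3.2.symm hnm
      · rw [List.concat_eq_append, ← List.append_assoc] at h3
        have := List.append_inj_right' h3 rfl
        simp at this
        simp [this]
  · right
    refine ⟨A' ++ [m], D, n' :: B, by rw [← h4, ← e]; simp, by simp, ?_, ?_, by simp⟩
    · cases D with
      | nil => simp at h3; exact absurd h3.2 hnm
      | cons d D => simp at h4; simp [h4.1]
    · rcases D.eq_nil_or_concat with rfl | ⟨D, d, rfl⟩
      · simp at h3; exact absurd h3.2 hnm
      · rw [List.concat_eq_append, ← List.append_assoc] at h3
        have := List.append_inj_right' h3 rfl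
        simp at this
        simp [this]

lemma head_eq_of_append {A B : List V} (h : (A ++ B).head? = some a) (hA : A ≠ []) :
    A.head? = some a := by
  cases A <;> simp_all

lemma last_eq_of_append {A B : List V} (h : (A ++ B).getLast? = some a) (hB : B ≠ []) :
    B.getLast? = some a := by
  rw [List.getLast?_append] at h
  obtain ⟨B, c, rfl⟩ := B.eq_nil_or_concat.resolve_left hB
  simpa using h

namespace MaxPath

lemma reverse (h : MaxPath G l a b H) : MaxPath G l.reverse b a H where
  chain := by
    rw [List.isChain_reverse]
    exact h.chain.imp fun _ _ h => h.symm
  nodup := by simpa using h.nodup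
  head := by simpa using h.last
  last := by simpa using h.head
  conn := h.conn
  disj := by simpa using h.disj
  max := by
    intro T h1 h2 h3
    simp only [List.mem_reverse] at *
    exact h.max T h1 h2 h3.symm

lemma span (h : MaxPath G l a b H) : Span G {x | x ∈ l} a b :=
  span_of_list h.chain h.nodup h.head h.last

/-- A path with the same ends through all of `l` and some vertices of `H` contradicts maximality. -/
lemma false_of_span (h : MaxPath G l a b H) {Q T : Set V} (hQ : Q ⊆ H) (hne : Q.Nonempty)
    (hT : ∀ x, x ∈ T ↔ x ∈ l ∨ x ∈ Q) (hs : Span G T a b) : False := by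
  obtain ⟨q, hq⟩ := hne
  refine h.disj q (hQ hq) (h.max T (fun x hx => (hT x).2 (Or.inl hx)) (fun x hx => ?_) hs
    ((hT q).2 (Or.inr hq)))
  rcases (hT x).1 hx with h | h
  · exact Or.inl h
  · exact Or.inr (hQ h)

/-- A connected set cannot be inserted between two consecutive vertices of a maximal path. -/
lemma not_touches_succ (h : MaxPath G l a b H) (hc : Consec l n n') (hn : Touches G n H) :
    ¬ Touches G n' H := by
  rintro ⟨k', hk', ha'⟩
  obtain ⟨k, hk, ha⟩ := hn
  obtain ⟨Q, hQ, hs⟩ := h.conn.exists_span hk hk'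
  obtain ⟨A, B, rfl⟩ := hc
  have e : A ++ n :: n' :: B = (A ++ [n]) ++ (n' :: B) := by simp
  have c := h.chain; have d := h.nodup; have hd := h.head; have hl := h.last; have hj := h.disj
  rw [e] at c d hd hl hj
  have s1 := span_of_list (v := n) c.left_of_append (List.nodup_append.1 d).1
    (head_eq_of_append hd (by simp)) (by simp)
  have s2 := span_of_list (u := n') c.right_of_append (List.nodup_append.1 d).2.1 (by simp)
    (last_eq_of_append hl (by simp))
  have s3 := s1.append hs (Set.disjoint_left.2 fun x hx hxQ => hj x (hQ hxQ)
    (List.mem_append_left _ hx)) ha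
  have s4 := s3.append s2 (Set.disjoint_left.2 fun x hx hxB => by
    rcases hx with hx | hx
    · exact (List.nodup_append.1 d).2.2 x hx x hxB rfl
    · exact hj x (hQ hx) (List.mem_append_right _ hxB)) ha'.symm
  refine h.false_of_span hQ ⟨k, hs.left_mem⟩ (fun x => ?_) s4
  rw [e]
  simp only [Set.mem_union, Set.mem_ofPred_eq, List.mem_append]
  tauto

/-- Successors of two attachment vertices of a connected set are not adjacent in a maximal path:
otherwise the part of the path between them could be reversed to make room for the set. -/
lemma not_adj_succ (h : MaxPath G l a b H) (hc : Consec l n n') (hc' : Consec l m m')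
    (hnm : n ≠ m) (hn : Touches G n H) (hm : Touches G m H) : ¬ G.Adj n' m' := by
  intro hadj
  wlog hw : ∃ A D B, l = A ++ (D ++ B) ∧ A.getLast? = some n ∧ D.head? = some n' ∧
      D.getLast? = some m ∧ B.head? = some m' generalizing n m n' m'
  · exact this hc' hc hnm.symm hm hn hadj.symm ((exists_three_parts hc hc' hnm).resolve_left hw)
  obtain ⟨A, D, B, rfl, hA, hD, hD', hB⟩ := hw
  obtain ⟨k, hk, ha⟩ := hn
  obtain ⟨k', hk', ha'⟩ := hm
  obtain ⟨Q, hQ, hs⟩ := h.conn.exists_span hk hk'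
  have c := h.chain; have d := h.nodup; have hd := h.head; have hl := h.last; have hj := h.disj
  have d1 := List.nodup_append.1 d
  have d2 := List.nodup_append.1 d1.2.1
  have s1 := span_of_list c.left_of_append d1.1
    (head_eq_of_append hd (by rintro rfl; simp at hA)) hA
  have s2 := span_of_list c.right_of_append.left_of_append d2.1 hD hD'
  have s3 := span_of_list c.right_of_append.right_of_append d2.2.1 hB
    (last_eq_of_append (last_eq_of_append hl (by
      have : D ≠ [] := by rintro rfl; simp at hD
      simp [this])) (by rintro rfl; simp at hB))
  have t1 := s1.append hs (Set.disjoint_left.2 fun x hx hxQ => hj x (hQ hxQ)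
    (List.mem_append_left _ hx)) ha
  have t2 := t1.append s2.symm (Set.disjoint_left.2 fun x hx hxB => by
    rcases hx with hx | hx
    · exact d1.2.2 x hx x (List.mem_append_left _ hxB) rfl
    · exact hj x (hQ hx) (List.mem_append_right _ (List.mem_append_left _ hxB))) ha'.symm
  have t3 := t2.append s3 (Set.disjoint_left.2 fun x hx hxB => by
    rcases hx with (hx | hx) | hx
    · exact d1.2.2 x hx x (List.mem_append_right _ hxB) rfl
    · exact hj x (hQ hx) (List.mem_append_right _ (List.mem_append_right _ hxB))
    · exact d2.2.2 x hx x hxB rfl) hadj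
  refine h.false_of_span hQ ⟨k, hs.left_mem⟩ (fun x => ?_) t3
  simp only [Set.mem_union, Set.mem_ofPred_eq, List.mem_append]
  tauto

/-- An independent set in `H` and the successors of attachment vertices of `H` form an independent
set. -/
lemma exists_indep (h : MaxPath G l a b H) {I N : Finset V} (hI : (I : Set V) ⊆ H)
    (hi : G.IsIndepSet (I : Set V)) (hN : ∀ n ∈ N, n ∈ l ∧ n ≠ b ∧ Touches G n H) :
    ∃ J : Finset V, J.card = I.card + N.card ∧ G.IsIndepSet (J : Set V) ∧
      ∀ v ∈ J, v ∈ H ∨ ∃ n ∈ N, Consec l n v := by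
  classical
  have hs : ∀ n, ∃ n', n ∈ N → Consec l n n' := by
    intro n
    by_cases hn : n ∈ N
    · obtain ⟨n', h'⟩ := exists_consec (hN n hn).1 h.last (hN n hn).2.1
      exact ⟨n', fun _ => h'⟩
    · exact ⟨n, fun h => absurd h hn⟩
  choose σ hσ using hs
  have hinj : Set.InjOn σ (N : Set V) := by
    intro x hx y hy hxy
    have h1 := hσ x hx
    rw [hxy] at h1
    exact h1.left_unique h.nodup (hσ y hy)
  have hIN : ∀ x ∈ I, ∀ n ∈ N, ¬ G.Adj x (σ n) := fun x hx n hn hadj =>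
    h.not_touches_succ (hσ n hn) (hN n hn).2.2 ⟨x, hI hx, hadj.symm⟩
  refine ⟨I ∪ N.image σ, ?_, ?_, ?_⟩
  · rw [Finset.card_union_of_disjoint, Finset.card_image_of_injOn hinj]
    refine Finset.disjoint_left.2 fun x hx hx' => ?_
    obtain ⟨n, hn, rfl⟩ := Finset.mem_image.1 hx'
    exact h.disj _ (hI hx) (hσ n hn).right_mem
  · intro x hx y hy hxy
    simp only [Finset.coe_union, Set.mem_union, Finset.mem_coe, Finset.mem_image] at hx hy
    rcases hx with hx | ⟨n, hn, rfl⟩ <;> rcases hy with hy | ⟨m, hm, rfl⟩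
    · exact hi hx hy hxy
    · exact hIN x hx m hm
    · exact fun h => hIN y hy n hn h.symm
    · exact h.not_adj_succ (hσ n hn) (hσ m hm) (fun e => hxy (e ▸ rfl)) (hN n hn).2.2 (hN m hm).2.2
  · intro v hv
    rcases Finset.mem_union.1 hv with hv | hv
    · exact Or.inl (hI hv)
    · obtain ⟨n, hn, rfl⟩ := Finset.mem_image.1 hv
      exact Or.inr ⟨n, hn, hσ n hn⟩

variable (h : MaxPath G l a b H)
  (hM : ∀ (T : Set V) (c : V), {x | x ∈ l} ⊆ T → T ⊆ {x | x ∈ l} ∪ H → c ∈ H → ¬ Span G T c b)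
include h hM

/-- The first vertex of the path has no neighbour in `H` if, by `hM`, no path starting in `H`
extends the vertex set of `l`. -/
lemma not_touches_head : ¬ Touches G a H := by
  rintro ⟨k, hk, ha⟩
  refine hM ({k} ∪ {x | x ∈ l}) k (fun x hx => Or.inr hx) ?_ hk
    ((Span.singleton G k).append h.span (Set.disjoint_left.2 ?_) ha.symm)
  · rintro x (rfl | hx)
    · exact Or.inr hk
    · exact Or.inl hx
  · rintro x rfl hx
    exact h.disj _ hk hx

/-- The first vertex of the path is not adjacent to the successor of an attachment vertex of `H`:
otherwise the first part of the path could be reversed and extended into `H`. -/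
lemma not_adj_head (hc : Consec l n n') (hn : Touches G n H) : ¬ G.Adj a n' := by
  intro hadj
  obtain ⟨k, hk, ha⟩ := hn
  obtain ⟨A, B, rfl⟩ := hc
  have e : A ++ n :: n' :: B = (A ++ [n]) ++ (n' :: B) := by simp
  have c := h.chain; have d := h.nodup; have hd := h.head; have hl := h.last; have hj := h.disj
  rw [e] at c d hd hl hj hM
  have s1 := span_of_list (v := n) c.left_of_append (List.nodup_append.1 d).1
    (head_eq_of_append hd (by simp)) (by simp)
  have s2 := span_of_list (u := n') c.right_of_append (List.nodup_append.1 d).2.1 (by simp)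
    (last_eq_of_append hl (by simp))
  have s3 := (Span.singleton G k).append s1.symm (Set.disjoint_left.2 (by
    rintro x rfl hx
    exact hj _ hk (List.mem_append_left _ hx))) ha.symm
  have s4 := s3.append s2 (Set.disjoint_left.2 (by
    rintro x (rfl | hx) hxB
    · exact hj _ hk (List.mem_append_right _ hxB)
    · exact (List.nodup_append.1 d).2.2 x hx x hxB rfl)) hadj
  refine hM _ k (fun x hx => ?_) ?_ hk s4
  · rw [Set.mem_ofPred_eq, List.mem_append] at hx
    rcases hx with hx | hx
    · exact Or.inl (Or.inr hx)
    · exact Or.inr hx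
  · rintro x ((rfl | hx) | hx)
    · exact Or.inr hk
    · exact Or.inl (List.mem_append_left _ hx)
    · exact Or.inl (List.mem_append_right _ hx)

/-- An independent set in `H`, the successors of attachment vertices of `H` and the first vertex of
the path form an independent set. -/
lemma exists_indep_head {I N : Finset V} (hI : (I : Set V) ⊆ H)
    (hi : G.IsIndepSet (I : Set V)) (hN : ∀ n ∈ N, n ∈ l ∧ n ≠ b ∧ Touches G n H) :
    ∃ J : Finset V, J.card = I.card + N.card + 1 ∧ G.IsIndepSet (J : Set V) ∧
      ∀ v ∈ J, v = a ∨ v ∈ H ∨ ∃ n ∈ N, Consec l n v := by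
  classical
  obtain ⟨J, h1, h2, h3⟩ := h.exists_indep hI hi hN
  have hal : a ∈ l := List.mem_of_head? h.head
  have ha : ∀ v ∈ J, ¬ G.Adj a v := by
    intro v hv hadj
    rcases h3 v hv with hv | ⟨n, hn, hc⟩
    · exact h.not_touches_head hM ⟨v, hv, hadj⟩
    · exact h.not_adj_head hM hc (hN n hn).2.2 hadj
  refine ⟨insert a J, ?_, ?_, ?_⟩
  · rw [Finset.card_insert_of_notMem, h1]
    intro hv
    rcases h3 a hv with hv | ⟨n, hn, hc⟩
    · exact h.disj a hv hal
    · exact hc.ne_head h.nodup h.head rfl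
  · intro x hx y hy hxy
    simp only [Finset.coe_insert, Set.mem_insert_iff, Finset.mem_coe] at hx hy
    rcases hx with rfl | hx <;> rcases hy with rfl | hy
    · exact absurd rfl hxy
    · exact ha y hy
    · exact fun h => ha x hx h.symm
    · exact h2 hx hy hxy
  · intro v hv
    rcases Finset.mem_insert.1 hv with rfl | hv
    · exact Or.inl rfl
    · exact Or.inr (h3 v hv)

end MaxPath

end

/-! ### Graphs with a cut vertex -/

/-- `A` and `B` are disjoint and no edge of `G` joins them. -/
def Anticomplete {V : Type*} (G : SimpleGraph V) (A B : Set V) : Prop :=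
  (∀ a ∈ A, a ∉ B) ∧ ∀ a ∈ A, ∀ b ∈ B, ¬ G.Adj a b

/-- `G - X` has at least `k` connected components: its vertices can be labelled by `Fin k`, with
every label in use, such that adjacent vertices have the same label. -/
def HasParts {V : Type*} (G : SimpleGraph V) (X : Set V) (k : ℕ) : Prop :=
  ∃ f : V → Fin k, (∀ i, ∃ v ∉ X, f v = i) ∧ ∀ u ∉ X, ∀ v ∉ X, G.Adj u v → f u = f v

/-- `S` consists of a clique `C ∪ {w}` and a clique `L`, and the edges in between all start in `w`,
so that `w` is a cut vertex of the subgraph induced by `S`. -/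
structure CliquePair {V : Type*} (G : SimpleGraph V) (S : Set V) (w : V) (C L : Set V) : Prop where
  mem : ∀ a, a ∈ S ↔ a = w ∨ a ∈ C ∨ a ∈ L
  not_left : w ∉ C
  not_right : w ∉ L
  anti : Anticomplete G C L
  left_nonempty : C.Nonempty
  right_nonempty : L.Nonempty
  clique_left : G.IsClique (insert w C)
  clique_right : G.IsClique L
  adj : ∃ l ∈ L, G.Adj w l

section

variable {V : Type*} {G : SimpleGraph V} {S X A B C D L : Set V} {u v w x y l l' c : V}

lemma Anticomplete.symm (h : Anticomplete G A B) : Anticomplete G B A :=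
  ⟨fun b hb ha => h.1 b ha hb, fun b hb a ha hab => h.2 a ha b hb hab.symm⟩

lemma Anticomplete.mono_right (h : Anticomplete G A B) (hC : C ⊆ B) : Anticomplete G A C :=
  ⟨fun a ha hc => h.1 a ha (hC hc), fun a ha c hc => h.2 a ha c (hC hc)⟩

lemma hasParts_two (hA : A.Nonempty) (hB : B.Nonempty) (hX : ∀ v, v ∈ X → v ∉ A ∧ v ∉ B)
    (hcov : ∀ v ∉ X, v ∈ A ∨ v ∈ B) (h : Anticomplete G A B) : HasParts G X 2 := by
  classical
  obtain ⟨a, ha⟩ := hA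
  obtain ⟨b, hb⟩ := hB
  refine ⟨fun v => if v ∈ A then 0 else 1, ?_, ?_⟩
  · intro i
    fin_cases i
    · exact ⟨a, fun h => (hX a h).1 ha, by simp [ha]⟩
    · exact ⟨b, fun h => (hX b h).2 hb, by simp [h.symm.1 b hb]⟩
  · intro u hu v hv huv
    rcases hcov u hu with h1 | h1 <;> rcases hcov v hv with h2 | h2
    · simp [h1, h2]
    · exact absurd huv (h.2 u h1 v h2)
    · exact absurd huv.symm (h.2 v h2 u h1)
    · simp [h.symm.1 u h1, h.symm.1 v h2]

/-- A set `A` with no edge to the rest of `G - X` is one part more than those of `G - X - A`. -/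
lemma hasParts_succ {k : ℕ} (h : HasParts G (X ∪ A) k) (hA : A.Nonempty) (hX : ∀ v ∈ X, v ∉ A)
    (hn : ∀ a ∈ A, ∀ b ∉ A, b ∉ X → ¬ G.Adj a b) : HasParts G X (k + 1) := by
  classical
  obtain ⟨f, h1, h2⟩ := h
  obtain ⟨a, ha⟩ := hA
  refine ⟨fun v => if v ∈ A then Fin.last k else (f v).castSucc, ?_, ?_⟩
  · intro i
    induction i using Fin.lastCases with
    | last => exact ⟨a, fun h => hX a h ha, by simp [ha]⟩
    | cast i =>
      obtain ⟨v, hv, rfl⟩ := h1 i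
      simp only [Set.mem_union, not_or] at hv
      exact ⟨v, hv.1, by simp [hv.2]⟩
  · intro u hu v hv huv
    by_cases hu' : u ∈ A <;> by_cases hv' : v ∈ A
    · simp [hu', hv']
    · exact absurd huv (hn u hu' v hv' hv)
    · exact absurd huv.symm (hn v hv' u hu' hu)
    · simp [hu', hv', h2 u (by simp [hu, hu']) v (by simp [hv, hv']) huv]

lemma hasParts_three (hA : A.Nonempty) (hB : B.Nonempty) (hC : C.Nonempty)
    (hX : ∀ v, v ∈ X → v ∉ A ∧ v ∉ B ∧ v ∉ C) (hcov : ∀ v ∉ X, v ∈ A ∨ v ∈ B ∨ v ∈ C)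
    (h : Anticomplete G A B) (h' : Anticomplete G A C) (h'' : Anticomplete G B C) :
    HasParts G X 3 := by
  refine hasParts_succ (A := A) (hasParts_two hB hC ?_ ?_ h'') hA (fun v hv => (hX v hv).1) ?_
  · rintro v (hv | hv)
    · exact (hX v hv).2
    · exact ⟨h.1 v hv, h'.1 v hv⟩
  · intro v hv
    simp only [Set.mem_union, not_or] at hv
    exact (hcov v hv.1).resolve_left hv.2
  · intro a ha b hb hbX
    rcases hcov b hbX with h1 | h1 | h1
    · exact absurd h1 hb
    · exact h.2 a ha b h1
    · exact h'.2 a ha b h1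

namespace CliquePair

variable [Finite V] (h : CliquePair G S w C L)
include h

/-- The path runs through `C`, `w` and `L`. -/
lemma exists_span_of_mem_left (hc : c ∈ C) : ∃ u, Span G S c u := by
  obtain ⟨l, hl, hwl⟩ := h.adj
  obtain ⟨u, hu⟩ := exists_span_of_isClique h.clique_right hl
  have h1 : Span G (insert w C) c w := span_of_isClique h.clique_left (Or.inr hc) (Or.inl rfl)
    (fun e => h.not_left (e ▸ hc))
  refine ⟨u, h1.append' hu ?_ hwl fun a => ?_⟩
  · rintro a (rfl | ha)
    · exact h.not_right
    · exact h.anti.1 a ha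
  · rw [h.mem, Set.mem_insert_iff, or_assoc]

/-- The path runs through `L`, ending in a neighbour `l'` of `w`, and then through `C ∪ {w}`. -/
lemma exists_span_of_mem_right (hl : l ∈ L) (hl' : l' ∈ L) (hll : l' ≠ l ∨ L ⊆ {l})
    (hw : G.Adj w l') : ∃ u, Span G S l u := by
  have h1 : Span G L l l' := by
    by_cases e : l = l'
    · subst e
      refine (Span.singleton G l).congr_set fun a => ⟨fun ha => ?_, fun ha => ?_⟩
      · exact (hll.resolve_left (by simp)) ha
      · exact Set.mem_singleton_iff.1 ha ▸ hl
    · exact span_of_isClique h.clique_right hl hl' e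
  obtain ⟨u, hu⟩ := exists_span_of_isClique h.clique_left (Or.inl rfl)
  refine ⟨u, h1.append' hu ?_ hw.symm fun a => ?_⟩
  · rintro a ha (rfl | ha')
    · exact h.not_right ha
    · exact h.anti.1 a ha' ha
  · rw [h.mem, Set.mem_insert_iff]
    tauto

end CliquePair

/-- A connected vertex set with independence number at most two has a Hamiltonian path starting in
a given vertex unless it has a cut vertex: a path from that vertex which cannot be extended leaves
out a component with only one attachment vertex. -/
lemma exists_span_or_cliquePair [Finite V] (hS : ConnOn G S) (hα : AlphaLE G S 2) (hv : v ∈ S) :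
    (∃ u, Span G S v u) ∨ ∃ w C L, CliquePair G S w C L := by
  classical
  let F : Set (Set V) := {P | P ⊆ S ∧ ∃ b, Span G P v b}
  obtain ⟨P, ⟨hPS, b, hP⟩, hmax⟩ := F.toFinite.exists_maximal
    ⟨{v}, by simpa using hv, v, Span.singleton G v⟩
  by_cases hSP : S ⊆ P
  · exact Or.inl ⟨b, hP.congr_set fun a => ⟨fun h => hSP h, fun h => hPS h⟩⟩
  right
  obtain ⟨u, huS, huP⟩ := Set.not_subset.1 hSP
  obtain ⟨H, hHS, huH, hH, hcl⟩ := exists_component (S := S \ P) G ⟨huS, huP⟩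
  have hvP : v ∈ P := hP.left_mem
  have hbP : b ∈ P := hP.right_mem
  obtain ⟨l, h1, h2, h3, h4, h5⟩ := hP
  have hlP : {x | x ∈ l} = P := Set.ext h5
  have hsub : ∀ T, T ⊆ {x | x ∈ l} ∪ H → T ⊆ S := fun T hT x hx => by
    rcases hT hx with h | h
    · exact hPS ((h5 x).1 h)
    · exact (hHS h).1
  have hm : MaxPath G l v b H := ⟨h1, h2, h3, h4, hH, fun x hx hxl => (hHS hx).2 ((h5 x).1 hxl),
    fun T hT hT' hs => hlP ▸ hmax ⟨hsub T hT', b, hs⟩ (hlP ▸ hT)⟩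
  have hb : ¬ Touches G b H := by
    refine hm.reverse.not_touches_head fun T c hT hT' hc hs => ?_
    simp only [List.mem_reverse] at hT hT'
    exact (hHS hc).2 (hmax ⟨hsub T hT', c, hs.symm⟩ (hlP ▸ hT) hs.left_mem)
  -- Two attachment vertices of `H` would give an independent set of size three.
  have huniq : ∀ n ∈ P, ∀ m ∈ P, Touches G n H → Touches G m H → n = m := by
    intro n hn m hm' htn htm
    by_contra hnm
    obtain ⟨J, hJ, hJi, hJS⟩ := hm.exists_indep (I := {u}) (N := {n, m}) (by simpa using huH)
      (by simp) (by
        intro k hk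
        simp only [Finset.mem_insert, Finset.mem_singleton] at hk
        rcases hk with rfl | rfl
        · exact ⟨(h5 _).2 hn, fun e => hb (e ▸ htn), htn⟩
        · exact ⟨(h5 _).2 hm', fun e => hb (e ▸ htm), htm⟩)
    have := hα J (fun x hx => by
      rcases hJS x hx with h | ⟨k, -, hk⟩
      · exact (hHS h).1
      · exact hPS ((h5 x).1 hk.right_mem)) hJi
    rw [Finset.card_pair hnm] at hJ
    simp at hJ
    omega
  have hedge : ∀ a ∈ H, ∀ c ∈ S, c ∉ H → G.Adj a c → c ∈ P ∧ Touches G c H := by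
    intro a ha c hc hcH hac
    exact ⟨by_contra fun hcP => hcH (hcl a ha c ⟨hc, hcP⟩ hac), a, ha, hac.symm⟩
  obtain ⟨a, ha, w, hw, hwH, haw⟩ := hS.exists_adj (fun x hx => (hHS hx).1) ⟨u, huH⟩ hv
    (fun h => (hHS h).2 hvP)
  obtain ⟨hwP, hwt⟩ := hedge a ha w hw hwH haw
  set L := S \ insert w H with hL
  have hbL : b ∈ L := ⟨hPS hbP, by
    rintro (rfl | h)
    · exact hb hwt
    · exact (hHS h).2 hbP⟩
  have hwL : w ∉ L := fun h => h.2 (Or.inl rfl)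
  have hLS : L ⊆ S := Set.sdiff_subset
  have hanti : Anticomplete G H L := by
    refine ⟨fun x hx h => h.2 (Or.inr hx), fun x hx y hy hxy => ?_⟩
    obtain ⟨h6, h7⟩ := hedge x hx y hy.1 (fun h => hy.2 (Or.inr h)) hxy
    exact hy.2 (Or.inl (huniq y h6 w hwP h7 hwt))
  have hHS' : H ⊆ S := fun x hx => (hHS hx).1
  have hHc : G.IsClique H := alphaLE_one_iff.1 (hα.of_not_alphaLE hLS hHS'
    hanti.symm.1 hanti.symm.2 (not_alphaLE_zero ⟨b, hbL⟩) le_rfl)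
  have hLc : G.IsClique L := alphaLE_one_iff.1 (hα.of_not_alphaLE hHS' hLS
    hanti.1 hanti.2 (not_alphaLE_zero ⟨u, huH⟩) le_rfl)
  have hmem : ∀ x, x ∈ S ↔ x = w ∨ x ∈ H ∨ x ∈ L := by
    intro x
    by_cases h6 : x = w
    · simp [h6, hw]
    · by_cases h7 : x ∈ H
      · simp [h7, hHS' h7]
      · simp [hL, h6, h7]
  obtain ⟨k, hk, w', hw', hw'L, hkw⟩ := hS.exists_adj hLS ⟨b, hbL⟩ hw hwL
  have hkw' : G.Adj w k := by
    rcases (hmem w').1 hw' with rfl | h | h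
    · exact hkw.symm
    · exact absurd hkw.symm (hanti.2 w' h k hk)
    · exact absurd h hw'L
  -- By `α(S) ≤ 2`, the cut vertex `w` is adjacent to all of `H` or to all of `L`.
  by_cases hfull : ∀ c ∈ H, G.Adj w c
  · exact ⟨w, H, L, hmem, hwH, hwL, hanti, ⟨u, huH⟩, ⟨b, hbL⟩,
      hHc.insert fun c hc _ => hfull c hc, hLc, k, hk, hkw'⟩
  · push Not at hfull
    obtain ⟨c, hc, hwc⟩ := hfull
    refine ⟨w, L, H, fun x => (hmem x).trans (by tauto), hwL, hwH, hanti.symm, ⟨b, hbL⟩, ⟨u, huH⟩,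
      hLc.insert fun d hd _ => ?_, hHc, a, ha, haw.symm⟩
    by_contra hwd
    exact hanti.2 c hc d hd (hα.adj_of_triple hw (hHS' hc) (hLS hd) (fun e => hwH (e ▸ hc))
      (fun e => hwL (e ▸ hd)) (fun e => hanti.1 c hc (e ▸ hd)) hwc hwd)

/-- One side `A` of a cut vertex `x`, if it has independence number at most two, has a Hamiltonian
path starting in a neighbour of `x`. -/
lemma exists_span_of_adj_cutVertex [Finite V] (h3 : ∀ w, ¬ HasParts G {w} 3)
    (htri : ∀ x y z, HasParts G {x} 2 → HasParts G {y} 2 → HasParts G {z} 2 →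
      G.Adj x y → G.Adj y z → ¬ G.Adj x z)
    (hcov : ∀ v, v = x ∨ v ∈ A ∨ v ∈ B) (hxA : x ∉ A) (hxB : x ∉ B) (hAB : Anticomplete G A B)
    (hB : B.Nonempty) (hA : ConnOn G A) (hα : AlphaLE G A 2) (hadj : ∃ a ∈ A, G.Adj x a) :
    ∃ s ∈ A, G.Adj x s ∧ ∃ u, Span G A s u := by
  by_contra! hno
  obtain ⟨a, ha, hxa⟩ := hadj
  rcases exists_span_or_cliquePair hA hα ha with ⟨u, hu⟩ | ⟨w, C, L, hP⟩
  · exact hno a ha hxa u hu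
  have hC : ∀ c ∈ C, ¬ G.Adj x c := fun c hc hxc => by
    obtain ⟨u, hu⟩ := hP.exists_span_of_mem_left hc
    exact hno c ((hP.mem c).2 (Or.inr (Or.inl hc))) hxc u hu
  have hL : ∀ l ∈ L, G.Adj x l → ∀ l' ∈ L, G.Adj w l' → l' = l ∧ ¬ L ⊆ {l} := by
    intro l hl hxl l' hl' hwl'
    by_contra hcon
    obtain ⟨u, hu⟩ := hP.exists_span_of_mem_right hl hl' (by tauto) hwl'
    exact hno l ((hP.mem l).2 (Or.inr (Or.inr hl))) hxl u hu
  have hmem := hP.mem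
  have hwC := hP.not_left
  have hwL := hP.not_right
  have hCL := hP.anti
  have hwA : w ∈ A := (hmem w).2 (Or.inl rfl)
  have hCA : ∀ c ∈ C, c ∈ A := fun c hc => (hmem c).2 (Or.inr (Or.inl hc))
  have hLA : ∀ c ∈ L, c ∈ A := fun c hc => (hmem c).2 (Or.inr (Or.inr hc))
  by_cases hxL : ∃ l ∈ L, G.Adj x l
  · obtain ⟨l, hl, hxl⟩ := hxL
    obtain ⟨l', hl', hwl'⟩ := hP.adj
    obtain ⟨rfl, hLl⟩ := hL l hl hxl l' hl' hwl'
    have hLne : (L \ {l'}).Nonempty := by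
      obtain ⟨k, hk, hkl⟩ := Set.not_subset.1 hLl
      exact ⟨k, hk, hkl⟩
    have hwL' : ∀ k ∈ L \ {l'}, ¬ G.Adj w k := fun k hk hwk => hk.2 (hL l' hl hxl k hk.1 hwk).1
    have hxL' : ∀ k ∈ L \ {l'}, ¬ G.Adj x k := fun k hk hxk =>
      hk.2 (hL k hk.1 hxk l' hl hwl').1.symm
    -- The only neighbour of `w` in `L` is the only neighbour `l'` of `x` in `L`: a triangle of cut
    -- vertices `x`, `w`, `l'` or three components of `G - l'`.
    by_cases hxw : G.Adj x w
    · refine htri x w l' ?_ ?_ ?_ hxw hwl' hxl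
      · exact hasParts_two ⟨w, hwA⟩ hB (by simp [hxA, hxB]) (fun v hv => (hcov v).resolve_left hv)
          hAB
      · refine hasParts_two (A := C) (B := insert x (L ∪ B)) hP.left_nonempty ⟨x, Or.inl rfl⟩
          ?_ ?_ ⟨?_, ?_⟩
        · rintro v rfl
          refine ⟨hwC, ?_⟩
          rintro (h | h | h)
          · exact hxA (h ▸ hwA)
          · exact hwL h
          · exact hAB.1 _ hwA h
        · intro v hv
          rcases hcov v with h | h | h
          · exact Or.inr (Or.inl h)
          · rcases (hmem v).1 h with h | h | h
            · exact absurd h hv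
            · exact Or.inl h
            · exact Or.inr (Or.inr (Or.inl h))
          · exact Or.inr (Or.inr (Or.inr h))
        · rintro c hc (h | h | h)
          · exact hxA (h ▸ hCA c hc)
          · exact hCL.1 c hc h
          · exact hAB.1 c (hCA c hc) h
        · rintro c hc b (rfl | h | h)
          · exact fun h => hC c hc h.symm
          · exact hCL.2 c hc b h
          · exact hAB.2 c (hCA c hc) b h
      · refine hasParts_two (A := L \ {l'}) (B := insert w C ∪ insert x B) hLne
          ⟨x, Or.inr (Or.inl rfl)⟩ ?_ ?_ ⟨?_, ?_⟩
        · rintro v rfl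
          refine ⟨fun h => h.2 rfl, ?_⟩
          rintro ((h | h) | (h | h))
          · exact hwL (h ▸ hl)
          · exact hCL.1 _ h hl
          · exact hxA (h ▸ hLA _ hl)
          · exact hAB.1 _ (hLA _ hl) h
        · intro v hv
          rcases hcov v with h | h | h
          · exact Or.inr (Or.inr (Or.inl h))
          · rcases (hmem v).1 h with h | h | h
            · exact Or.inr (Or.inl (Or.inl h))
            · exact Or.inr (Or.inl (Or.inr h))
            · exact Or.inl ⟨h, hv⟩
          · exact Or.inr (Or.inr (Or.inr h))
        · rintro k hk ((h | h) | (h | h))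
          · exact hwL (h ▸ hk.1)
          · exact hCL.1 _ h hk.1
          · exact hxA (h ▸ hLA _ hk.1)
          · exact hAB.1 _ (hLA _ hk.1) h
        · rintro k hk b ((rfl | h) | (rfl | h))
          · exact fun h => hwL' k hk h.symm
          · exact fun h' => hCL.2 b h k hk.1 h'.symm
          · exact fun h => hxL' k hk h.symm
          · exact hAB.2 k (hLA _ hk.1) b h
    · refine h3 l' (hasParts_three (A := L \ {l'}) (B := insert w C) (C := insert x B) hLne
        ⟨w, Or.inl rfl⟩ ⟨x, Or.inl rfl⟩ ?_ ?_ ⟨?_, ?_⟩ ⟨?_, ?_⟩ ⟨?_, ?_⟩)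
      · rintro v rfl
        refine ⟨fun h => h.2 rfl, ?_, ?_⟩
        · rintro (h | h)
          · exact hwL (h ▸ hl)
          · exact hCL.1 _ h hl
        · rintro (h | h)
          · exact hxA (h ▸ hLA _ hl)
          · exact hAB.1 _ (hLA _ hl) h
      · intro v hv
        rcases hcov v with h | h | h
        · exact Or.inr (Or.inr (Or.inl h))
        · rcases (hmem v).1 h with h | h | h
          · exact Or.inr (Or.inl (Or.inl h))
          · exact Or.inr (Or.inl (Or.inr h))
          · exact Or.inl ⟨h, hv⟩
        · exact Or.inr (Or.inr (Or.inr h))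
      · rintro k hk (h | h)
        · exact hwL (h ▸ hk.1)
        · exact hCL.1 _ h hk.1
      · rintro k hk b (rfl | h)
        · exact fun h => hwL' k hk h.symm
        · exact fun h' => hCL.2 b h k hk.1 h'.symm
      · rintro k hk (h | h)
        · exact hxA (h ▸ hLA _ hk.1)
        · exact hAB.1 _ (hLA _ hk.1) h
      · rintro k hk b (rfl | h)
        · exact fun h => hxL' k hk h.symm
        · exact hAB.2 k (hLA _ hk.1) b h
      · rintro c (rfl | hc) (h | h)
        · exact hxA (h ▸ hwA)
        · exact hAB.1 _ hwA h
        · exact hxA (h ▸ hCA _ hc)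
        · exact hAB.1 _ (hCA _ hc) h
      · rintro c (rfl | hc) b (rfl | h)
        · exact fun h => hxw h.symm
        · exact hAB.2 _ hwA b h
        · exact fun h => hC c hc h.symm
        · exact hAB.2 _ (hCA _ hc) b h
  · push Not at hxL
    refine h3 w (hasParts_three (A := C) (B := L) (C := insert x B) hP.left_nonempty
      hP.right_nonempty ⟨x, Or.inl rfl⟩ ?_ ?_ hCL ⟨?_, ?_⟩ ⟨?_, ?_⟩)
    · rintro v rfl
      refine ⟨hwC, hwL, ?_⟩
      rintro (h | h)
      · exact hxA (h ▸ hwA)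
      · exact hAB.1 _ hwA h
    · intro v hv
      rcases hcov v with h | h | h
      · exact Or.inr (Or.inr (Or.inl h))
      · rcases (hmem v).1 h with h | h | h
        · exact absurd h hv
        · exact Or.inl h
        · exact Or.inr (Or.inl h)
      · exact Or.inr (Or.inr (Or.inr h))
    · rintro k hk (h | h)
      · exact hxA (h ▸ hCA _ hk)
      · exact hAB.1 _ (hCA _ hk) h
    · rintro k hk b (rfl | h)
      · exact fun h => hC k hk h.symm
      · exact hAB.2 k (hCA _ hk) b h
    · rintro k hk (h | h)
      · exact hxA (h ▸ hLA _ hk)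
      · exact hAB.1 _ (hLA _ hk) h
    · rintro k hk b (rfl | h)
      · exact fun h => hxL k hk h.symm
      · exact hAB.2 k (hLA _ hk) b h

/-- If one of two parts of `G - X` is disconnected, there are three parts. -/
lemma connOn_of_not_hasParts_three (h3 : ¬ HasParts G X 3) (hB : B.Nonempty)
    (hX : ∀ v, v ∈ X → v ∉ A ∧ v ∉ B) (hcov : ∀ v ∉ X, v ∈ A ∨ v ∈ B) (h : Anticomplete G A B) :
    ConnOn G A := by
  by_contra hn
  obtain ⟨C, D, hC, hD, hA, hCD, hCD'⟩ := exists_split hn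
  refine h3 (hasParts_three hC hD hB ?_ ?_ ⟨hCD, hCD'⟩ (h.symm.mono_right ?_).symm
    (h.symm.mono_right ?_).symm)
  · intro v hv
    have := hX v hv
    have := hA v
    tauto
  · intro v hv
    have := hcov v hv
    have := hA v
    tauto
  · exact fun a ha => (hA a).2 (Or.inl ha)
  · exact fun a ha => (hA a).2 (Or.inr ha)

lemma exists_hasParts_two_sets (h : HasParts G X 2) : ∃ A B : Set V, A.Nonempty ∧ B.Nonempty ∧
    (∀ v, v ∈ X → v ∉ A ∧ v ∉ B) ∧ (∀ v ∉ X, v ∈ A ∨ v ∈ B) ∧ Anticomplete G A B := by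
  obtain ⟨f, h1, h2⟩ := h
  obtain ⟨a, ha, ha'⟩ := h1 0
  obtain ⟨b, hb, hb'⟩ := h1 1
  refine ⟨{v | v ∉ X ∧ f v = 0}, {v | v ∉ X ∧ f v = 1}, ⟨a, ha, ha'⟩, ⟨b, hb, hb'⟩, ?_, ?_, ?_, ?_⟩
  · exact fun v hv => ⟨fun h => h.1 hv, fun h => h.1 hv⟩
  · intro v hv
    have : f v = 0 ∨ f v = 1 := by omega
    exact this.imp (⟨hv, ·⟩) (⟨hv, ·⟩)
  · rintro v ⟨_, h0⟩ ⟨_, h1⟩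
    rw [h0] at h1
    exact absurd h1 (by decide)
  · rintro v ⟨hv, h0⟩ w ⟨hw, h1⟩ hvw
    have := h2 v hv w hw hvw
    rw [h0, h1] at this
    exact absurd this (by decide)

/-- Hamiltonian paths for connected graphs with a cut vertex and independence number at most four.
The hypothesis `hc` treats the case that one side of a cut vertex is a clique and the other has
independence number at most three; otherwise both sides have independence number two. -/
lemma exists_span_of_cutVertex [Finite V] (hG : ConnOn G Set.univ) (hα : AlphaLE G Set.univ 4)
    (h3 : ∀ w, ¬ HasParts G {w} 3)
    (htri : ∀ x y z, HasParts G {x} 2 → HasParts G {y} 2 → HasParts G {z} 2 →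
      G.Adj x y → G.Adj y z → ¬ G.Adj x z)
    (hx : HasParts G {x} 2)
    (hc : ∀ Q₁ Q₂ : Set V, Q₁.Nonempty → Q₂.Nonempty → x ∉ Q₁ → x ∉ Q₂ →
      (∀ v, v = x ∨ v ∈ Q₁ ∨ v ∈ Q₂) → Anticomplete G Q₁ Q₂ → ConnOn G Q₁ → ConnOn G Q₂ →
      G.IsClique Q₁ → AlphaLE G Q₂ 3 → ∃ u ∈ Q₂, G.Adj x u ∧ ∃ v, Span G Q₂ u v) :
    ∃ u v, Span G Set.univ u v := by
  obtain ⟨A, B, hA, hB, hX, hcov, hAB⟩ := exists_hasParts_two_sets hx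
  obtain ⟨hxA, hxB⟩ := hX x rfl
  have hAc : ConnOn G A := connOn_of_not_hasParts_three (h3 x) hB hX hcov hAB
  have hBc : ConnOn G B := connOn_of_not_hasParts_three (h3 x) hA
    (fun v hv => (hX v hv).symm) (fun v hv => (hcov v hv).symm) hAB.symm
  have hcov' : ∀ v, v = x ∨ v ∈ A ∨ v ∈ B := fun v => or_iff_not_imp_left.2 (hcov v)
  have hnbr : ∀ A B : Set V, A.Nonempty → x ∉ A → (∀ v, v = x ∨ v ∈ A ∨ v ∈ B) →
      Anticomplete G A B → ∃ a ∈ A, G.Adj x a := by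
    intro A B hA hxA hcov hAB
    obtain ⟨a, ha, b, -, hbA, hab⟩ := hG.exists_adj (Set.subset_univ A) hA (Set.mem_univ x) hxA
    rcases hcov b with rfl | h | h
    · exact ⟨a, ha, hab.symm⟩
    · exact absurd h hbA
    · exact absurd hab (hAB.2 a ha b h)
  have hjoin : ∀ s t, s ∈ A → t ∈ B → G.Adj x s → G.Adj x t → (∃ u, Span G A s u) →
      (∃ u, Span G B t u) → ∃ u v, Span G Set.univ u v := by
    rintro s t hs ht hxs hxt ⟨u, hu⟩ ⟨v, hv⟩
    have h1 := hu.symm.append (Span.singleton G x) (by simpa using hxA) hxs.symm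
    refine ⟨u, v, h1.append' hv ?_ hxt fun a => ?_⟩
    · rintro a (ha | rfl)
      · exact hAB.1 a ha
      · exact hxB
    · have := hcov' a
      simp only [Set.mem_univ, Set.mem_union, Set.mem_singleton_iff]
      tauto
  by_cases hA1 : G.IsClique A
  · obtain ⟨u, hu, hxu, hv⟩ := hc A B hA hB hxA hxB hcov' hAB hAc hBc hA1
      (hα.of_not_alphaLE (Set.subset_univ A) (Set.subset_univ B) hAB.1 hAB.2
        (not_alphaLE_zero hA) le_rfl)
    obtain ⟨s, hs, hxs⟩ := hnbr A B hA hxA hcov' hAB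
    exact hjoin s u hs hu hxs hxu (exists_span_of_isClique hA1 hs) hv
  by_cases hB1 : G.IsClique B
  · obtain ⟨u, hu, hxu, hv⟩ := hc B A hB hA hxB hxA (fun v => (hcov' v).imp_right Or.symm)
      hAB.symm hBc hAc hB1
      (hα.of_not_alphaLE (Set.subset_univ B) (Set.subset_univ A) hAB.symm.1 hAB.symm.2
        (not_alphaLE_zero hB) le_rfl)
    obtain ⟨s, hs, hxs⟩ := hnbr B A hB hxB (fun v => (hcov' v).imp_right Or.symm) hAB.symm
    exact hjoin u s hu hs hxu hxs hv (exists_span_of_isClique hB1 hs)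
  · rw [← alphaLE_one_iff] at hA1 hB1
    have hA2 : AlphaLE G A 2 := hα.of_not_alphaLE (Set.subset_univ B) (Set.subset_univ A)
      hAB.symm.1 hAB.symm.2 hB1 le_rfl
    have hB2 : AlphaLE G B 2 := hα.of_not_alphaLE (Set.subset_univ A) (Set.subset_univ B)
      hAB.1 hAB.2 hA1 le_rfl
    obtain ⟨s, hs, hxs, hu⟩ := exists_span_of_adj_cutVertex h3 htri hcov' hxA hxB hAB hB hAc hA2
      (hnbr A B hA hxA hcov' hAB)
    obtain ⟨t, ht, hxt, hv⟩ := exists_span_of_adj_cutVertex h3 htri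
      (fun v => (hcov' v).imp_right Or.symm) hxB hxA hAB.symm hA hBc hB2
      (hnbr B A hB hxB (fun v => (hcov' v).imp_right Or.symm) hAB.symm)
    exact hjoin s t hs ht hxs hxt hu hv

end

/-! ### Graphs without cut vertices: sets with two outer neighbours -/

section

variable {V : Type*} {G : SimpleGraph V} {S X A B C D K L R H H' : Set V}
  {u v w x y z p q t : V}

/-- In a graph without cut vertices, the neighbours of a set `K` outside `K` are not all equal to
`w`, unless `K` and `w` are the whole graph. -/
lemma exists_adj_ne (h2 : ∀ w, ¬ HasParts G {w} 2) (hK : K.Nonempty) (hw : w ∉ K) (hv : v ∉ K)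
    (hvw : v ≠ w) : ∃ a ∈ K, ∃ b ∉ K, b ≠ w ∧ G.Adj a b := by
  by_contra! h
  refine h2 w (hasParts_two (A := K) (B := {u | u ∉ K ∧ u ≠ w}) hK ⟨v, hv, hvw⟩ ?_ ?_ ⟨?_, ?_⟩)
  · rintro u rfl
    exact ⟨hw, fun h => h.2 rfl⟩
  · intro u hu
    by_cases hK : u ∈ K
    · exact Or.inl hK
    · exact Or.inr ⟨hK, hu⟩
  · exact fun a ha h => h.1 ha
  · exact fun a ha b hb => h a ha b hb.1 hb.2

lemma Touches.of_adj {a : V} (ha : a ∈ K) (h : G.Adj a v) : Touches G v K := ⟨a, ha, h.symm⟩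

lemma exists_touches_ne (h2 : ∀ w, ¬ HasParts G {w} 2) (hK : K.Nonempty) (hw : w ∉ K) (hv : v ∉ K)
    (hvw : v ≠ w) : ∃ b ∉ K, b ≠ w ∧ Touches G b K := by
  obtain ⟨a, ha, b, hb, hbw, hab⟩ := exists_adj_ne h2 hK hw hv hvw
  exact ⟨b, hb, hbw, .of_adj ha hab⟩

/-- A clique with only two outer neighbours `p` and `q` in a graph without cut vertices has a
Hamiltonian path from a neighbour of `p` to a neighbour of `q`. -/
lemma exists_span_of_two_neighbors [Finite V] (h2 : ∀ w, ¬ HasParts G {w} 2) (hK : K.Nonempty)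
    (hc : G.IsClique K) (hp : p ∉ K) (hq : q ∉ K) (hpq : p ≠ q)
    (hN : ∀ a ∈ K, ∀ b ∉ K, G.Adj a b → b = p ∨ b = q) :
    ∃ s ∈ K, ∃ t ∈ K, G.Adj p s ∧ G.Adj q t ∧ Span G K s t := by
  obtain ⟨s, hs, b, hb, hbq, hsb⟩ := exists_adj_ne h2 hK hq hp hpq
  obtain rfl : b = p := (hN s hs b hb hsb).resolve_right hbq
  obtain ⟨t, ht, c, hc', hcp, htc⟩ := exists_adj_ne h2 hK hp hq hpq.symm
  obtain rfl : c = q := (hN t ht c hc' htc).resolve_left hcp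
  by_cases hst : s = t
  · subst hst
    by_cases hks : ∃ k ∈ K, k ≠ s
    · obtain ⟨k, hk, hks⟩ := hks
      obtain ⟨k', hk', d, hd, hds, hkd⟩ := exists_adj_ne (K := K \ {s}) (w := s) (v := b) h2
        ⟨k, hk, hks⟩ (fun h => h.2 rfl) (fun h => hp h.1) (fun e => hp (e ▸ hs))
      have hdK : d ∉ K := fun h => hd ⟨h, hds⟩
      rcases hN k' hk'.1 d hdK hkd with rfl | rfl
      · exact ⟨k', hk'.1, s, hs, hkd.symm, htc.symm, span_of_isClique hc hk'.1 hs hk'.2⟩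
      · exact ⟨s, hs, k', hk'.1, hsb.symm, hkd.symm, span_of_isClique hc hs hk'.1
          (fun e => hk'.2 e.symm)⟩
    · push Not at hks
      exact ⟨s, hs, s, hs, hsb.symm, htc.symm, (Span.singleton G s).congr_set fun a =>
        ⟨fun h => hks a h, fun h => by rw [Set.mem_singleton_iff.1 h]; exact hs⟩⟩
  · exact ⟨s, hs, t, ht, hsb.symm, htc.symm, span_of_isClique hc hs ht hst⟩

/-- A connected set with independence number at most two, in a graph without cut vertices, has a
Hamiltonian path starting in a vertex with a neighbour outside. -/
lemma exists_span_to_outside [Finite V] (hG : ConnOn G Set.univ) (h2 : ∀ w, ¬ HasParts G {w} 2)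
    (hS : ConnOn G S) (hα : AlphaLE G S 2) (hne : S.Nonempty) (ht : t ∉ S) :
    ∃ s ∈ S, ∃ b ∉ S, G.Adj s b ∧ ∃ u, Span G S s u := by
  obtain ⟨a, ha, b, -, hb, hab⟩ := hG.exists_adj (Set.subset_univ S) hne (Set.mem_univ t) ht
  rcases exists_span_or_cliquePair hS hα ha with h | ⟨w, C, L, h⟩
  · exact ⟨a, ha, b, hb, hab, h⟩
  · have hm := h.mem
    obtain ⟨c, hc, d, hd, hdw, hcd⟩ := exists_adj_ne (v := t) h2 h.left_nonempty h.not_left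
      (fun h => ht ((hm t).2 (Or.inr (Or.inl h)))) (fun e => ht ((hm t).2 (Or.inl e)))
    refine ⟨c, (hm c).2 (Or.inr (Or.inl hc)), d, fun hdS => ?_, hcd, h.exists_span_of_mem_left hc⟩
    rcases (hm d).1 hdS with h' | h' | h'
    · exact hdw h'
    · exact hd h'
    · exact h.anti.2 c hc d h' hcd

/-- The case of `span_of_three_parts` in which it is known which parts are cliques. -/
lemma span_of_three_parts_aux [Finite V] (hG : ConnOn G Set.univ) (h2 : ∀ w, ¬ HasParts G {w} 2)
    (hxy : x ≠ y)
    (hX : ∀ v, v = x ∨ v = y → v ∉ A ∧ v ∉ B ∧ v ∉ C)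
    (hcov : ∀ v, v = x ∨ v = y ∨ v ∈ A ∨ v ∈ B ∨ v ∈ C)
    (hA : A.Nonempty) (hB : B.Nonempty) (hC : C.Nonempty)
    (hAB : Anticomplete G A B) (hAC : Anticomplete G A C) (hBC : Anticomplete G B C)
    (hAc : G.IsClique A) (hBc : G.IsClique B) (hCc : ConnOn G C) (hCα : AlphaLE G C 2) :
    ∃ u v, Span G Set.univ u v := by
  have hx := hX x (Or.inl rfl)
  have hy := hX y (Or.inr rfl)
  obtain ⟨s, hs, b, hb, hsb, u, hu⟩ := exists_span_to_outside hG h2 hCc hCα hC hx.2.2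
  wlog hbx : b = x generalizing x y
  · have hby : b = y := by
      rcases hcov b with h | h | h | h | h
      · exact absurd h hbx
      · exact h
      · exact absurd hsb.symm (hAC.2 b h s hs)
      · exact absurd hsb.symm (hBC.2 b h s hs)
      · exact absurd h hb
    exact this hxy.symm (fun v hv => hX v hv.symm) (fun v => by have := hcov v; tauto) hy hx hby
  subst hbx
  obtain ⟨s1, hs1, t1, ht1, hbs, hyt, hA'⟩ := exists_span_of_two_neighbors h2 hA hAc hx.1 hy.1 hxy
    (fun a ha c hc hac => by
      rcases hcov c with h | h | h | h | h
      · exact Or.inl h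
      · exact Or.inr h
      · exact absurd h hc
      · exact absurd hac (hAB.2 a ha c h)
      · exact absurd hac (hAC.2 a ha c h))
  obtain ⟨s2, hs2, t2, ht2, hbs2, hyt2, hB'⟩ := exists_span_of_two_neighbors h2 hB hBc hx.2.1 hy.2.1
    hxy (fun a ha c hc hac => by
      rcases hcov c with h | h | h | h | h
      · exact Or.inl h
      · exact Or.inr h
      · exact absurd hac.symm (hAB.2 c h a ha)
      · exact absurd h hc
      · exact absurd hac (hBC.2 a ha c h))
  have e1 := hu.symm.append (Span.singleton G b) (by simpa using hx.2.2) hsb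
  have e2 := e1.append hA' (Set.disjoint_left.2 (by
    rintro a (ha | rfl) h
    · exact hAC.1 a h ha
    · exact hx.1 h)) hbs
  have e3 := e2.append (Span.singleton G y) (by
    simp only [Set.disjoint_singleton_right, Set.mem_union, Set.mem_singleton_iff]
    tauto) hyt.symm
  refine ⟨u, s2, e3.append' hB'.symm ?_ hyt2 fun a => ?_⟩
  · rintro a (((ha | rfl) | ha) | rfl)
    · exact hBC.symm.1 a ha
    · exact hx.2.1
    · exact hAB.1 a ha
    · exact hy.2.1
  · have := hcov a
    simp only [Set.mem_univ, Set.mem_union, Set.mem_singleton_iff]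
    tauto

/-- A graph without cut vertices and with independence number at most four, in which the deletion
of two vertices leaves at most three components, has a Hamiltonian path if some pair `x`, `y` does
leave three components: two of them are cliques, the third has independence number at most two, and
a Hamiltonian path runs through the third, `x`, a clique, `y` and the other clique. -/
lemma span_of_three_parts [Finite V] (hG : ConnOn G Set.univ) (hα : AlphaLE G Set.univ 4)
    (h2 : ∀ w, ¬ HasParts G {w} 2) (h4 : ∀ x y, x ≠ y → ¬ HasParts G {x, y} 4) (hxy : x ≠ y)
    (hX : ∀ v, v = x ∨ v = y → v ∉ A ∧ v ∉ B ∧ v ∉ C)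
    (hcov : ∀ v, v = x ∨ v = y ∨ v ∈ A ∨ v ∈ B ∨ v ∈ C)
    (hA : A.Nonempty) (hB : B.Nonempty) (hC : C.Nonempty)
    (hAB : Anticomplete G A B) (hAC : Anticomplete G A C) (hBC : Anticomplete G B C) :
    ∃ u v, Span G Set.univ u v := by
  have hconn : ∀ A B C : Set V, A.Nonempty → B.Nonempty →
      (∀ v, v = x ∨ v = y → v ∉ A ∧ v ∉ B ∧ v ∉ C) →
      (∀ v, v = x ∨ v = y ∨ v ∈ A ∨ v ∈ B ∨ v ∈ C) →
      Anticomplete G A B → Anticomplete G A C → Anticomplete G B C → ConnOn G C := by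
    intro A B C hA hB hX hcov hAB hAC hBC
    refine connOn_of_not_hasParts_three (X := {x, y} ∪ A) (B := B) (fun h => h4 x y hxy ?_) hB
      ?_ ?_ hBC.symm
    · refine hasParts_succ h hA (fun v hv => (hX v hv).1) fun a ha b hb hbX => ?_
      simp only [Set.mem_insert_iff, Set.mem_singleton_iff, not_or] at hbX
      rcases hcov b with h | h | h | h | h
      · exact absurd h hbX.1
      · exact absurd h hbX.2
      · exact absurd h hb
      · exact hAB.2 a ha b h
      · exact hAC.2 a ha b h
    · rintro v (hv | hv)
      · exact (hX v hv).2.symm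
      · exact ⟨hAC.1 v hv, hAB.1 v hv⟩
    · intro v hv
      simp only [Set.mem_union, Set.mem_insert_iff, Set.mem_singleton_iff] at hv
      have := hcov v
      tauto
  -- If two of the parts are not cliques, an independent set of five vertices arises.
  have key : ∀ A B C : Set V, C.Nonempty → Anticomplete G A B → Anticomplete G A C →
      Anticomplete G B C → ¬ G.IsClique A → G.IsClique B := by
    intro A B C hC hAB hAC hBC hAc
    have h1 : AlphaLE G (B ∪ C) 2 := by
      refine hα.of_not_alphaLE (Set.subset_univ A) (Set.subset_univ _) ?_ ?_
        (fun h => hAc (alphaLE_one_iff.1 h)) le_rfl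
      · rintro a ha (h | h)
        · exact hAB.1 a ha h
        · exact hAC.1 a ha h
      · rintro a ha b (h | h)
        · exact hAB.2 a ha b h
        · exact hAC.2 a ha b h
    exact alphaLE_one_iff.1 (h1.of_not_alphaLE Set.subset_union_right Set.subset_union_left
      hBC.symm.1 hBC.symm.2 (not_alphaLE_zero hC) le_rfl)
  have key' : ∀ A B C : Set V, A.Nonempty → B.Nonempty → Anticomplete G A B →
      Anticomplete G A C → Anticomplete G B C → AlphaLE G C 2 := by
    intro A B C hA hB hAB hAC hBC
    have h1 : AlphaLE G (B ∪ C) 3 := by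
      refine hα.of_not_alphaLE (Set.subset_univ A) (Set.subset_univ _) ?_ ?_
        (not_alphaLE_zero hA) le_rfl
      · rintro a ha (h | h)
        · exact hAB.1 a ha h
        · exact hAC.1 a ha h
      · rintro a ha b (h | h)
        · exact hAB.2 a ha b h
        · exact hAC.2 a ha b h
    exact h1.of_not_alphaLE Set.subset_union_left Set.subset_union_right
      hBC.1 hBC.2 (not_alphaLE_zero hB) le_rfl
  have aux : ∀ A B C : Set V, A.Nonempty → B.Nonempty → C.Nonempty →
      (∀ v, v = x ∨ v = y → v ∉ A ∧ v ∉ B ∧ v ∉ C) →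
      (∀ v, v = x ∨ v = y ∨ v ∈ A ∨ v ∈ B ∨ v ∈ C) →
      Anticomplete G A B → Anticomplete G A C → Anticomplete G B C →
      G.IsClique A → G.IsClique B → ∃ u v, Span G Set.univ u v :=
    fun A B C hA hB hC hX hcov hAB hAC hBC hAc hBc =>
      span_of_three_parts_aux hG h2 hxy hX hcov hA hB hC hAB hAC hBC hAc hBc
        (hconn A B C hA hB hX hcov hAB hAC hBC) (key' A B C hA hB hAB hAC hBC)
  by_cases hAc : G.IsClique A
  · by_cases hBc : G.IsClique B
    · exact aux A B C hA hB hC hX hcov hAB hAC hBC hAc hBc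
    · exact aux A C B hA hC hB (fun v hv => by have := hX v hv; tauto)
        (fun v => by have := hcov v; tauto) hAC hAB hBC.symm hAc
        (key B C A hA hBC hAB.symm hAC.symm hBc)
  · exact aux B C A hB hC hA (fun v hv => by have := hX v hv; tauto)
      (fun v => by have := hcov v; tauto) hBC hAB.symm hAC.symm
      (key A B C hC hAB hAC hBC hAc) (key A C B hB hAC hAB hBC.symm hAc)

/-- The case of `span_of_three_parts` where two parts are given by their outer neighbours. -/
lemma span_of_two_attached [Finite V] (hG : ConnOn G Set.univ) (hα : AlphaLE G Set.univ 4)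
    (h2 : ∀ w, ¬ HasParts G {w} 2) (h4 : ∀ x y, x ≠ y → ¬ HasParts G {x, y} 4) (hxy : x ≠ y)
    (hA : A.Nonempty) (hB : B.Nonempty) (hxA : x ∉ A) (hyA : y ∉ A) (hxB : x ∉ B) (hyB : y ∉ B)
    (hAB : Anticomplete G A B) (hAN : ∀ b ∉ A, Touches G b A → b = x ∨ b = y)
    (hBN : ∀ b ∉ B, Touches G b B → b = x ∨ b = y)
    (hv : v ≠ x ∧ v ≠ y ∧ v ∉ A ∧ v ∉ B) : ∃ u v, Span G Set.univ u v := by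
  refine span_of_three_parts (C := {v | v ≠ x ∧ v ≠ y ∧ v ∉ A ∧ v ∉ B}) hG hα h2 h4 hxy ?_ ?_ hA hB
    ⟨v, hv⟩ hAB ⟨?_, ?_⟩ ⟨?_, ?_⟩
  · rintro v (rfl | rfl)
    · exact ⟨hxA, hxB, fun h => h.1 rfl⟩
    · exact ⟨hyA, hyB, fun h => h.2.1 rfl⟩
  · intro v
    simp only [Set.mem_ofPred_eq]
    tauto
  · exact fun a ha h => h.2.2.1 ha
  · intro a ha b hb hab
    rcases hAN b hb.2.2.1 (.of_adj ha hab) with h | h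
    · exact hb.1 h
    · exact hb.2.1 h
  · exact fun a ha h => h.2.2.2 ha
  · intro a ha b hb hab
    rcases hBN b hb.2.2.2 (.of_adj ha hab) with h | h
    · exact hb.1 h
    · exact hb.2.1 h

/-- If the complement of a connected set `R` with independence number at most two has Hamiltonian
paths starting in all its vertices with a neighbour in `R`, the graph has a Hamiltonian path. -/
lemma span_of_connOn [Finite V] (hG : ConnOn G Set.univ) (h2 : ∀ w, ¬ HasParts G {w} 2)
    (hR : ConnOn G R) (hα : AlphaLE G R 2) (hne : R.Nonempty) (ht : t ∉ R)
    (hM : ∀ t ∉ R, Touches G t R → ∃ u, Span G Rᶜ t u) : ∃ u v, Span G Set.univ u v := by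
  obtain ⟨s, hs, b, hb, hsb, u, hu⟩ := exists_span_to_outside hG h2 hR hα hne ht
  obtain ⟨v, hv⟩ := hM b hb (Touches.of_adj hs hsb)
  exact ⟨u, v, hu.symm.append' hv (fun a ha h => h ha) hsb fun a => by
    simp [Classical.em]⟩

/-- If the complement of `R` has a Hamiltonian path from `p` to `q` and `R` consists of two cliques,
one attached to `p` and the other to `q`, the graph has a Hamiltonian path. -/
lemma span_of_two_cliques [Finite V] (hAc : G.IsClique A) (hBc : G.IsClique B)
    (hAB : Anticomplete G A B) (hR : ∀ a, a ∈ R ↔ a ∈ A ∨ a ∈ B) (hs : Span G Rᶜ p q)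
    (hp : Touches G p A) (hq : Touches G q B) : ∃ u v, Span G Set.univ u v := by
  obtain ⟨a, ha, hpa⟩ := hp
  obtain ⟨b, hb, hqb⟩ := hq
  obtain ⟨u, hu⟩ := exists_span_of_isClique hAc ha
  obtain ⟨v, hv⟩ := exists_span_of_isClique hBc hb
  have e1 := hu.symm.append hs (Set.disjoint_left.2 fun x hx h => h ((hR x).2 (Or.inl hx))) hpa.symm
  refine ⟨u, v, e1.append' hv ?_ hqb fun x => ?_⟩
  · rintro x (hx | hx)
    · exact hAB.1 x hx
    · exact fun h => hx ((hR x).2 (Or.inr h))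
  · have := hR x
    simp only [Set.mem_univ, Set.mem_union, Set.mem_compl_iff]
    tauto

/-- Two vertices, one in `H` and one in `H'`, extend any independent set in `R`. -/
lemma alphaLE_two_of_anticomplete (hα : AlphaLE G Set.univ 4) (hH : H.Nonempty) (hH' : H'.Nonempty)
    (h1 : Anticomplete G H H') (h2 : Anticomplete G H R) (h3 : Anticomplete G H' R) :
    AlphaLE G R 2 := by
  have h : AlphaLE G (H' ∪ R) 3 := by
    refine hα.of_not_alphaLE (Set.subset_univ H) (Set.subset_univ _) ?_ ?_
      (not_alphaLE_zero hH) le_rfl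
    · rintro a ha (h | h)
      · exact h1.1 a ha h
      · exact h2.1 a ha h
    · rintro a ha b (h | h)
      · exact h1.2 a ha b h
      · exact h2.2 a ha b h
  exact h.of_not_alphaLE Set.subset_union_left Set.subset_union_right
      h3.1 h3.2 (not_alphaLE_zero hH') le_rfl

lemma isClique_of_split (hα : AlphaLE G R 2) (hR : ∀ a, a ∈ R ↔ a ∈ A ∨ a ∈ B)
    (hB : B.Nonempty) (hAB : Anticomplete G A B) : G.IsClique A :=
  alphaLE_one_iff.1 (hα.of_not_alphaLE (fun b hb => (hR b).2 (Or.inr hb))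
    (fun a ha => (hR a).2 (Or.inl ha)) hAB.symm.1 hAB.symm.2 (not_alphaLE_zero hB) le_rfl)

/-- A Hamiltonian path from two cliques `H` and `H'`, whose outer neighbours are `x, y` and `z, y`,
where `x` and `z` are adjacent. The rest `R` of the graph has independence number at most two; it is
attached to an end of a Hamiltonian path of its complement, or consists of two cliques, which are
attached to both ends of such a path from `x` to `z`. -/
lemma span_of_cliques_common [Finite V] (hG : ConnOn G Set.univ) (hα : AlphaLE G Set.univ 4)
    (h2 : ∀ w, ¬ HasParts G {w} 2) (h4 : ∀ x y, x ≠ y → ¬ HasParts G {x, y} 4)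
    (hxy : x ≠ y) (hxz : x ≠ z) (hyz : y ≠ z) (hadj : G.Adj x z)
    (hH : H.Nonempty) (hHc : G.IsClique H) (hH' : H'.Nonempty) (hHc' : G.IsClique H')
    (hx : x ∉ H ∧ x ∉ H') (hy : y ∉ H ∧ y ∉ H') (hz : z ∉ H ∧ z ∉ H') (hHH : Anticomplete G H H')
    (hN : ∀ a ∈ H, ∀ b ∉ H, G.Adj a b → b = x ∨ b = y)
    (hN' : ∀ a ∈ H', ∀ b ∉ H', G.Adj a b → b = z ∨ b = y)
    (hv : v ≠ x ∧ v ≠ y ∧ v ≠ z ∧ v ∉ H ∧ v ∉ H') : ∃ u v, Span G Set.univ u v := by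
  obtain ⟨s1, hs1, t1, ht1, hxs, hyt, hs⟩ := exists_span_of_two_neighbors h2 hH hHc hx.1 hy.1 hxy hN
  obtain ⟨s2, hs2, t2, ht2, hzs, hyt', hs'⟩ :=
    exists_span_of_two_neighbors h2 hH' hHc' hz.2 hy.2 hyz.symm hN'
  obtain ⟨R, hR⟩ : ∃ R : Set V, R = {v | v ≠ x ∧ v ≠ y ∧ v ≠ z ∧ v ∉ H ∧ v ∉ H'} := ⟨_, rfl⟩
  have hRm : ∀ v, v ∈ R ↔ v ≠ x ∧ v ≠ y ∧ v ≠ z ∧ v ∉ H ∧ v ∉ H' := fun v => by rw [hR]; rfl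
  have hHR : Anticomplete G H R := ⟨by grind, by grind⟩
  have hHR' : Anticomplete G H' R := ⟨by grind, by grind⟩
  have hHd := hHH.1
  have hRα : AlphaLE G R 2 := alphaLE_two_of_anticomplete hα hH hH' hHH hHR hHR'
  have hzx : Span G Rᶜ z x := by
    have e1 := (Span.singleton G z).append hs' (by simpa using hz.2) hzs
    have e2 := e1.append (Span.singleton G y) (by simp; grind) hyt'.symm
    have e3 := e2.append hs.symm (Set.disjoint_left.2 (by simp; grind)) hyt
    refine e3.append' (Span.singleton G x) (by simp; grind) hxs.symm fun a => ?_
    simp [hRm]; grind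
  have hyx : Span G Rᶜ y t1 := by
    have e1 := (Span.singleton G y).append hs'.symm (by simpa using hy.2) hyt'
    have e2 := e1.append (Span.singleton G z) (by simp; grind) hzs.symm
    have e3 := e2.append (Span.singleton G x) (by simp; grind) hadj.symm
    refine e3.append' hs (by simp; grind) hxs fun a => ?_
    simp [hRm]; grind
  have hout : ∀ K ⊆ R, (∀ a ∈ K, ∀ b ∈ R, b ∉ K → ¬ G.Adj a b) → ∀ b ∉ K, Touches G b K →
      b = x ∨ b = y ∨ b = z := by
    rintro K hK hKR b hb ⟨a, ha, hba⟩
    have h5 : b ∉ R := fun h => hKR a ha b h hb hba.symm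
    have h6 : b ∉ H := fun h => hHR.2 b h a (hK ha) hba
    have h7 : b ∉ H' := fun h => hHR'.2 b h a (hK ha) hba
    rw [hRm] at h5
    tauto
  by_cases hRc : ConnOn G R
  · refine span_of_connOn (t := x) hG h2 hRc hRα ⟨v, (hRm v).2 hv⟩ (by simp [hRm]) ?_
    intro t ht htr
    rcases hout R subset_rfl (fun a _ b hb hb' => absurd hb hb') t ht htr with
      rfl | rfl | rfl
    · exact ⟨_, hzx.symm⟩
    · exact ⟨_, hyx⟩
    · exact ⟨_, hzx⟩
  obtain ⟨A, B, hA, hB, hRAB, hAB, hAB'⟩ := exists_split hRc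
  have hanti : Anticomplete G A B := ⟨hAB, hAB'⟩
  have hAc : G.IsClique A := isClique_of_split hRα hRAB hB hanti
  have hBc : G.IsClique B :=
    isClique_of_split hRα (fun a => (hRAB a).trans or_comm) hA hanti.symm
  have hAR : A ⊆ R := fun a ha => (hRAB a).2 (Or.inl ha)
  have hBR : B ⊆ R := fun a ha => (hRAB a).2 (Or.inr ha)
  have hAN := hout A hAR fun a ha b hb hbA => hAB' a ha b (((hRAB b).1 hb).resolve_left hbA)
  have hBN := hout B hBR fun a ha b hb hbB h =>
    hAB' b (((hRAB b).1 hb).resolve_right hbB) a ha h.symm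
  by_cases c1 : Touches G z A ∧ Touches G x B
  · exact span_of_two_cliques hAc hBc hanti hRAB hzx c1.1 c1.2
  by_cases c2 : Touches G x A ∧ Touches G z B
  · exact span_of_two_cliques hAc hBc hanti hRAB hzx.symm c2.1 c2.2
  have htwo : ∀ K ⊆ R, K.Nonempty → (∀ b ∉ K, Touches G b K → b = x ∨ b = y ∨ b = z) →
      (Touches G y K ∨ Touches G z K) ∧ (Touches G x K ∨ Touches G z K) ∧
      (Touches G x K ∨ Touches G y K) := by
    intro K hK hKne hKN
    have hxK : x ∉ K := fun h => ((hRm x).1 (hK h)).1 rfl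
    have hyK : y ∉ K := fun h => ((hRm y).1 (hK h)).2.1 rfl
    have hzK : z ∉ K := fun h => ((hRm z).1 (hK h)).2.2.1 rfl
    have hom : ∀ {p q}, p ∉ K → q ∉ K → q ≠ p →
        ((x ≠ p ∧ Touches G x K) ∨ (y ≠ p ∧ Touches G y K) ∨ (z ≠ p ∧ Touches G z K)) := by
      intro p q hp hq hqp
      obtain ⟨b, hb, hbp, ht⟩ := exists_touches_ne h2 hKne hp hq hqp
      rcases hKN b hb ht with rfl | rfl | rfl
      · exact Or.inl ⟨hbp, ht⟩
      · exact Or.inr (Or.inl ⟨hbp, ht⟩)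
      · exact Or.inr (Or.inr ⟨hbp, ht⟩)
    refine ⟨?_, ?_, ?_⟩
    · simpa [hxy.symm, hxz.symm] using hom hxK hyK hxy.symm
    · simpa [hxy, hyz.symm] using hom hyK hxK hxy
    · simpa [hxz, hyz] using hom hzK hxK hxz
  have tA := htwo A hAR hA hAN
  have tB := htwo B hBR hB hBN
  have hcase : (¬ Touches G x A ∧ ¬ Touches G x B) ∨ (¬ Touches G z A ∧ ¬ Touches G z B) := by
    by_cases hxA : Touches G x A
    · have hzB : ¬ Touches G z B := fun h => c2 ⟨hxA, h⟩
      exact Or.inr ⟨fun h => c1 ⟨h, tB.2.1.resolve_right hzB⟩, hzB⟩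
    · exact Or.inl ⟨hxA, fun h => c1 ⟨tA.2.1.resolve_left hxA, h⟩⟩
  have hxR : x ∉ R := by simp [hRm]
  have hyR : y ∉ R := by simp [hRm]
  have hzR : z ∉ R := by simp [hRm]
  rcases hcase with ⟨hA1, hB1⟩ | ⟨hA1, hB1⟩
  · refine span_of_two_attached (x := y) (y := z) (v := x) hG hα h2 h4 hyz hA hB
      (fun h => hyR (hAR h)) (fun h => hzR (hAR h)) (fun h => hyR (hBR h)) (fun h => hzR (hBR h))
      hanti ?_ ?_ ⟨hxy, hxz, fun h => hxR (hAR h), fun h => hxR (hBR h)⟩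
    · exact fun b hb ht => (hAN b hb ht).resolve_left fun e => hA1 (e ▸ ht)
    · exact fun b hb ht => (hBN b hb ht).resolve_left fun e => hB1 (e ▸ ht)
  · refine span_of_two_attached (x := x) (y := y) (v := z) hG hα h2 h4 hxy hA hB
      (fun h => hxR (hAR h)) (fun h => hyR (hAR h)) (fun h => hxR (hBR h)) (fun h => hyR (hBR h))
      hanti ?_ ?_ ⟨hxz.symm, hyz.symm, fun h => hzR (hAR h), fun h => hzR (hBR h)⟩
    · exact fun b hb ht => (or_assoc.2 (hAN b hb ht)).resolve_right fun e => hA1 (e ▸ ht)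
    · exact fun b hb ht => (or_assoc.2 (hBN b hb ht)).resolve_right fun e => hB1 (e ▸ ht)

/-- A Hamiltonian path from two cliques `H` and `H'`, whose outer neighbours are `x, y` and `z, w`,
where `x, z` and `y, w` are adjacent, so that `x, H, y, w, H', z` form a cycle. The rest `R` of the
graph has independence number at most two, so it is connected or consists of two cliques. -/
lemma span_of_cliques_disjoint [Finite V] (hG : ConnOn G Set.univ) (hα : AlphaLE G Set.univ 4)
    (h2 : ∀ w, ¬ HasParts G {w} 2) (h4 : ∀ x y, x ≠ y → ¬ HasParts G {x, y} 4)
    (hd : [x, y, z, w].Nodup) (hadj : G.Adj x z) (hadj' : G.Adj y w)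
    (hH : H.Nonempty) (hHc : G.IsClique H) (hH' : H'.Nonempty) (hHc' : G.IsClique H')
    (hx : x ∉ H ∧ x ∉ H') (hy : y ∉ H ∧ y ∉ H') (hz : z ∉ H ∧ z ∉ H') (hw : w ∉ H ∧ w ∉ H')
    (hHH : Anticomplete G H H')
    (hN : ∀ a ∈ H, ∀ b ∉ H, G.Adj a b → b = x ∨ b = y)
    (hN' : ∀ a ∈ H', ∀ b ∉ H', G.Adj a b → b = z ∨ b = w)
    (hv : v ≠ x ∧ v ≠ y ∧ v ≠ z ∧ v ≠ w ∧ v ∉ H ∧ v ∉ H') : ∃ u v, Span G Set.univ u v := by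
  have hd' : (x ≠ y ∧ x ≠ z ∧ x ≠ w) ∧ (y ≠ z ∧ y ≠ w) ∧ z ≠ w := by simpa using hd
  obtain ⟨⟨hxy, hxz, hxw⟩, ⟨hyz, hyw⟩, hzw⟩ := hd'
  obtain ⟨s1, hs1, t1, ht1, hxs, hyt, hs⟩ := exists_span_of_two_neighbors h2 hH hHc hx.1 hy.1 hxy hN
  obtain ⟨s2, hs2, t2, ht2, hzs, hwt, hs'⟩ :=
    exists_span_of_two_neighbors h2 hH' hHc' hz.2 hw.2 hzw hN'
  obtain ⟨R, hR⟩ : ∃ R : Set V, R = {v | v ≠ x ∧ v ≠ y ∧ v ≠ z ∧ v ≠ w ∧ v ∉ H ∧ v ∉ H'} :=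
    ⟨_, rfl⟩
  have hRm : ∀ v, v ∈ R ↔ v ≠ x ∧ v ≠ y ∧ v ≠ z ∧ v ≠ w ∧ v ∉ H ∧ v ∉ H' :=
    fun v => by rw [hR]; rfl
  have hHR : Anticomplete G H R := ⟨by grind, by grind⟩
  have hHR' : Anticomplete G H' R := ⟨by grind, by grind⟩
  have hHd := hHH.1
  have hRα : AlphaLE G R 2 := alphaLE_two_of_anticomplete hα hH hH' hHH hHR hHR'
  have hzx : Span G Rᶜ z x := by
    have e1 := (Span.singleton G z).append hs' (by simpa using hz.2) hzs
    have e2 := e1.append (Span.singleton G w) (by simp; grind) hwt.symm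
    have e3 := e2.append (Span.singleton G y) (by simp; grind) hadj'.symm
    have e4 := e3.append hs.symm (Set.disjoint_left.2 (by simp; grind)) hyt
    refine e4.append' (Span.singleton G x) (by simp; grind) hxs.symm fun a => ?_
    simp [hRm]; grind
  have hyw' : Span G Rᶜ y w := by
    have e1 := (Span.singleton G y).append hs.symm (by simpa using hy.1) hyt
    have e2 := e1.append (Span.singleton G x) (by simp; grind) hxs.symm
    have e3 := e2.append (Span.singleton G z) (by simp; grind) hadj
    have e4 := e3.append hs' (Set.disjoint_left.2 (by simp; grind)) hzs
    refine e4.append' (Span.singleton G w) (by simp; grind) hwt.symm fun a => ?_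
    simp [hRm]; grind
  have hout : ∀ K ⊆ R, (∀ a ∈ K, ∀ b ∈ R, b ∉ K → ¬ G.Adj a b) → ∀ b ∉ K, Touches G b K →
      b = x ∨ b = y ∨ b = z ∨ b = w := by
    rintro K hK hKR b hb ⟨a, ha, hba⟩
    have h5 : b ∉ R := fun h => hKR a ha b h hb hba.symm
    have h6 : b ∉ H := fun h => hHR.2 b h a (hK ha) hba
    have h7 : b ∉ H' := fun h => hHR'.2 b h a (hK ha) hba
    rw [hRm] at h5
    tauto
  by_cases hRc : ConnOn G R
  · refine span_of_connOn (t := x) hG h2 hRc hRα ⟨v, (hRm v).2 hv⟩ (by simp [hRm]) ?_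
    intro t ht htr
    rcases hout R subset_rfl (fun a _ b hb hb' => absurd hb hb') t ht htr with
      rfl | rfl | rfl | rfl
    · exact ⟨_, hzx.symm⟩
    · exact ⟨_, hyw'⟩
    · exact ⟨_, hzx⟩
    · exact ⟨_, hyw'.symm⟩
  obtain ⟨A, B, hA, hB, hRAB, hAB, hAB'⟩ := exists_split hRc
  have hanti : Anticomplete G A B := ⟨hAB, hAB'⟩
  have hAc : G.IsClique A := isClique_of_split hRα hRAB hB hanti
  have hBc : G.IsClique B :=
    isClique_of_split hRα (fun a => (hRAB a).trans or_comm) hA hanti.symm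
  have hAR : A ⊆ R := fun a ha => (hRAB a).2 (Or.inl ha)
  have hBR : B ⊆ R := fun a ha => (hRAB a).2 (Or.inr ha)
  have hAN := hout A hAR fun a ha b hb hbA => hAB' a ha b (((hRAB b).1 hb).resolve_left hbA)
  have hBN := hout B hBR fun a ha b hb hbB h =>
    hAB' b (((hRAB b).1 hb).resolve_right hbB) a ha h.symm
  by_cases c1 : Touches G z A ∧ Touches G x B
  · exact span_of_two_cliques hAc hBc hanti hRAB hzx c1.1 c1.2
  by_cases c2 : Touches G x A ∧ Touches G z B
  · exact span_of_two_cliques hAc hBc hanti hRAB hzx.symm c2.1 c2.2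
  by_cases c3 : Touches G y A ∧ Touches G w B
  · exact span_of_two_cliques hAc hBc hanti hRAB hyw' c3.1 c3.2
  by_cases c4 : Touches G w A ∧ Touches G y B
  · exact span_of_two_cliques hAc hBc hanti hRAB hyw'.symm c4.1 c4.2
  have hnot : ∀ K ⊆ R, x ∉ K ∧ y ∉ K ∧ z ∉ K ∧ w ∉ K := fun K hK =>
    ⟨fun h => ((hRm x).1 (hK h)).1 rfl, fun h => ((hRm y).1 (hK h)).2.1 rfl,
      fun h => ((hRm z).1 (hK h)).2.2.1 rfl, fun h => ((hRm w).1 (hK h)).2.2.2.1 rfl⟩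
  obtain ⟨hxA, hyA, hzA, hwA⟩ := hnot A hAR
  obtain ⟨hxB, hyB, hzB, hwB⟩ := hnot B hBR
  have htwo : ∀ K ⊆ R, K.Nonempty →
      (∀ b ∉ K, Touches G b K → b = x ∨ b = y ∨ b = z ∨ b = w) →
      (Touches G y K ∨ Touches G z K ∨ Touches G w K) ∧
      (Touches G x K ∨ Touches G z K ∨ Touches G w K) ∧
      (Touches G x K ∨ Touches G y K ∨ Touches G w K) ∧
      (Touches G x K ∨ Touches G y K ∨ Touches G z K) := by
    intro K hK hKne hKN
    obtain ⟨hxK, hyK, hzK, hwK⟩ := hnot K hK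
    have hom : ∀ {p q}, p ∉ K → q ∉ K → q ≠ p → ((x ≠ p ∧ Touches G x K) ∨
        (y ≠ p ∧ Touches G y K) ∨ (z ≠ p ∧ Touches G z K) ∨ (w ≠ p ∧ Touches G w K)) := by
      intro p q hp hq hqp
      obtain ⟨b, hb, hbp, ht⟩ := exists_touches_ne h2 hKne hp hq hqp
      rcases hKN b hb ht with rfl | rfl | rfl | rfl
      · exact Or.inl ⟨hbp, ht⟩
      · exact Or.inr (Or.inl ⟨hbp, ht⟩)
      · exact Or.inr (Or.inr (Or.inl ⟨hbp, ht⟩))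
      · exact Or.inr (Or.inr (Or.inr ⟨hbp, ht⟩))
    refine ⟨?_, ?_, ?_, ?_⟩
    · simpa [hxy.symm, hxz.symm, hxw.symm] using hom hxK hyK hxy.symm
    · simpa [hxy, hyz.symm, hyw.symm] using hom hyK hxK hxy
    · simpa [hxz, hyz, hzw.symm] using hom hzK hxK hxz
    · simpa [hxw, hyw, hzw] using hom hwK hxK hxw
  have tA := htwo A hAR hA hAN
  have tB := htwo B hBR hB hBN
  -- If `B` is attached to `y` and `w` only, a Hamiltonian path runs through `A`, `x`, `H`, `y`,
  -- `B`, `w`, `H'`, `z`.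
  have special : ∀ A B : Set V, (∀ a, a ∈ R ↔ a ∈ A ∨ a ∈ B) → Anticomplete G A B → B.Nonempty →
      G.IsClique A → G.IsClique B → (x ∉ B ∧ y ∉ B ∧ z ∉ B ∧ w ∉ B) → Touches G x A →
      ¬ Touches G x B → ¬ Touches G z B →
      (∀ b ∉ B, Touches G b B → b = x ∨ b = y ∨ b = z ∨ b = w) →
      ∃ u v, Span G Set.univ u v := by
    rintro A B hRAB hanti hB hAc hBc ⟨hxB, hyB, hzB, hwB⟩ ⟨a, ha, hxa⟩ hxB' hzB' hBN
    obtain ⟨u, hu⟩ := exists_span_of_isClique hAc ha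
    obtain ⟨s3, hs3, t3, ht3, hys, hwt3, hs3'⟩ :=
      exists_span_of_two_neighbors h2 hB hBc hyB hwB hyw
        (fun a ha b hb hab => by
          have ht : Touches G b B := .of_adj ha hab
          rcases hBN b hb ht with rfl | rfl | rfl | rfl
          · exact absurd ht hxB'
          · exact Or.inl rfl
          · exact absurd ht hzB'
          · exact Or.inr rfl)
    have hABd := hanti.1
    have e1 := hu.symm.append (Span.singleton G x) (by simp; grind) hxa.symm
    have e2 := e1.append hs (Set.disjoint_left.2 (by simp; grind)) hxs
    have e3 := e2.append (Span.singleton G y) (by simp; grind) hyt.symm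
    have e4 := e3.append hs3' (Set.disjoint_left.2 (by simp; grind)) hys
    have e5 := e4.append (Span.singleton G w) (by simp; grind) hwt3.symm
    have e6 := e5.append hs'.symm (Set.disjoint_left.2 (by simp; grind)) hwt
    refine ⟨u, z, e6.append' (Span.singleton G z) (by simp; grind) hzs.symm fun a => ?_⟩
    simp; grind
  by_cases s1 : Touches G x A ∧ ¬ Touches G x B ∧ ¬ Touches G z B
  · exact special A B hRAB hanti hB hAc hBc ⟨hxB, hyB, hzB, hwB⟩ s1.1 s1.2.1 s1.2.2 hBN
  by_cases s2 : Touches G x B ∧ ¬ Touches G x A ∧ ¬ Touches G z A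
  · exact special B A (fun a => (hRAB a).trans or_comm) hanti.symm hA hBc hAc
      ⟨hxA, hyA, hzA, hwA⟩ s2.1 s2.2.1 s2.2.2 hAN
  have hcase : (¬ Touches G z A ∧ ¬ Touches G w A ∧ ¬ Touches G z B ∧ ¬ Touches G w B) ∨
      (¬ Touches G z A ∧ ¬ Touches G y A ∧ ¬ Touches G z B ∧ ¬ Touches G y B) ∨
      (¬ Touches G x A ∧ ¬ Touches G w A ∧ ¬ Touches G x B ∧ ¬ Touches G w B) ∨
      (¬ Touches G x A ∧ ¬ Touches G y A ∧ ¬ Touches G x B ∧ ¬ Touches G y B) := by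
    clear hAN hBN hN hN' htwo special hout hnot h2 h4 hRm hRα hα hG hzx hyw' hs hs' hRAB hR
    grind
  have hpick : ∀ {K : Set V} {p q p' q' : V},
      (∀ b ∉ K, Touches G b K → b = p ∨ b = q ∨ b = p' ∨ b = q') → ¬ Touches G p' K →
      ¬ Touches G q' K → ∀ b ∉ K, Touches G b K → b = p ∨ b = q := by
    rintro K p q p' q' hK h h' b hb ht
    rcases hK b hb ht with rfl | rfl | rfl | rfl
    · exact Or.inl rfl
    · exact Or.inr rfl
    · exact absurd ht h
    · exact absurd ht h'
  rcases hcase with ⟨k1, k2, k3, k4⟩ | ⟨k1, k2, k3, k4⟩ | ⟨k1, k2, k3, k4⟩ | ⟨k1, k2, k3, k4⟩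
  · exact span_of_two_attached (x := x) (y := y) (v := z) hG hα h2 h4 hxy hA hB
      hxA hyA hxB hyB hanti (hpick (p' := z) (q' := w) (fun b hb ht => by
        rcases hAN b hb ht with h | h | h | h <;> simp [h]) k1 k2)
      (hpick (p' := z) (q' := w) (fun b hb ht => by
        rcases hBN b hb ht with h | h | h | h <;> simp [h]) k3 k4) ⟨hxz.symm, hyz.symm, hzA, hzB⟩
  · exact span_of_two_attached (x := x) (y := w) (v := z) hG hα h2 h4 hxw hA hB
      hxA hwA hxB hwB hanti (hpick (p' := z) (q' := y) (fun b hb ht => by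
        rcases hAN b hb ht with h | h | h | h <;> simp [h]) k1 k2)
      (hpick (p' := z) (q' := y) (fun b hb ht => by
        rcases hBN b hb ht with h | h | h | h <;> simp [h]) k3 k4) ⟨hxz.symm, hzw, hzA, hzB⟩
  · exact span_of_two_attached (x := z) (y := y) (v := x) hG hα h2 h4 hyz.symm hA hB
      hzA hyA hzB hyB hanti (hpick (p' := x) (q' := w) (fun b hb ht => by
        rcases hAN b hb ht with h | h | h | h <;> simp [h]) k1 k2)
      (hpick (p' := x) (q' := w) (fun b hb ht => by
        rcases hBN b hb ht with h | h | h | h <;> simp [h]) k3 k4) ⟨hxz, hxy, hxA, hxB⟩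
  · exact span_of_two_attached (x := z) (y := w) (v := x) hG hα h2 h4 hzw hA hB
      hzA hwA hzB hwB hanti (hpick (p' := x) (q' := y) (fun b hb ht => by
        rcases hAN b hb ht with h | h | h | h <;> simp [h]) k1 k2)
      (hpick (p' := x) (q' := y) (fun b hb ht => by
        rcases hBN b hb ht with h | h | h | h <;> simp [h]) k3 k4) ⟨hxz, hxw, hxA, hxB⟩

end

/-! ### Paths running through a set with two outer neighbours -/

section

variable {V : Type*} {G : SimpleGraph V} {H H' : Set V} {l A Q C : List V} {a b u v w x y z h₀ : V}

/-- A list starting outside `H` and meeting `H` has a first step into `H`. -/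
lemma exists_first_entry {l : List V} (hl : ∃ h ∈ l, h ∈ H) (hh : ∀ a, l.head? = some a → a ∉ H) :
    ∃ A p k R, l = A ++ p :: k :: R ∧ (∀ v ∈ A, v ∉ H) ∧ p ∉ H ∧ k ∈ H := by
  induction l with
  | nil => simp at hl
  | cons c l ih =>
    have hc : c ∉ H := hh c rfl
    have hl' : ∃ h ∈ l, h ∈ H := by
      obtain ⟨k, hk, hkH⟩ := hl
      rcases List.mem_cons.1 hk with rfl | hk
      · exact absurd hkH hc
      · exact ⟨k, hk, hkH⟩
    cases l with
    | nil => simp at hl'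
    | cons d l =>
      by_cases hd : d ∈ H
      · exact ⟨[], c, d, l, rfl, by simp, hc, hd⟩
      · obtain ⟨A, p, k, R, h1, h2, h3, h4⟩ := ih hl' (by
          rintro a ha
          simp only [List.head?_cons, Option.some.injEq] at ha
          exact ha ▸ hd)
        refine ⟨c :: A, p, k, R, by rw [h1]; rfl, ?_, h3, h4⟩
        rintro v hv
        rcases List.mem_cons.1 hv with rfl | hv
        · exact hc
        · exact h2 v hv

lemma exists_first_exit {l : List V} (hl : ∃ c ∈ l, c ∉ H) :
    ∃ Q q C, l = Q ++ q :: C ∧ (∀ v ∈ Q, v ∈ H) ∧ q ∉ H := by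
  induction l with
  | nil => simp at hl
  | cons c l ih =>
    by_cases hc : c ∈ H
    · obtain ⟨Q, q, C, h1, h2, h3⟩ := ih (by
        obtain ⟨k, hk, hkH⟩ := hl
        rcases List.mem_cons.1 hk with rfl | hk
        · exact absurd hc hkH
        · exact ⟨k, hk, hkH⟩)
      refine ⟨c :: Q, q, C, by rw [h1]; rfl, ?_, h3⟩
      rintro v hv
      rcases List.mem_cons.1 hv with rfl | hv
      · exact hc
      · exact h2 v hv
    · exact ⟨[], c, l, rfl, by simp, hc⟩

lemma adj_of_first_exit {k q : V} {R Q C : List V} (hc : (k :: R).IsChain G.Adj)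
    (he : k :: R = Q ++ q :: C) (hk : k ∈ H) (hQ : ∀ v ∈ Q, v ∈ H) (hq : q ∉ H) :
    ∃ s ∈ H, G.Adj s q := by
  rcases Q.eq_nil_or_concat with rfl | ⟨Q, s, rfl⟩
  · simp at he
    exact absurd (he.1 ▸ hk) hq
  · refine ⟨s, hQ s (by simp), ?_⟩
    rw [he] at hc
    have : Consec (Q.concat s ++ q :: C) s q := ⟨Q, C, by simp⟩
    exact this.adj hc

/-- A path with ends outside `H` runs through a set `H` with only two outer neighbours `x` and `y`
in one piece, between `x` and `y`. -/
lemma exists_excursion (hc : l.IsChain G.Adj) (hn : l.Nodup) (ha : l.head? = some a) (haH : a ∉ H)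
    (hb : l.getLast? = some b) (hbH : b ∉ H) (hne : H.Nonempty) (hHl : ∀ h ∈ H, h ∈ l)
    (hN : ∀ a ∈ H, ∀ b ∉ H, G.Adj a b → b = x ∨ b = y) :
    ∃ p q A Q C, ((p = x ∧ q = y) ∨ (p = y ∧ q = x)) ∧ l = A ++ p :: (Q ++ q :: C) ∧
      ∀ v, v ∈ Q ↔ v ∈ H := by
  obtain ⟨h, hh⟩ := hne
  obtain ⟨A, p, k, R, rfl, hA, hp, hk⟩ := exists_first_entry ⟨h, hHl h hh, hh⟩
    (fun a' ha' => by rw [ha] at ha'; simp only [Option.some.injEq] at ha'; exact ha' ▸ haH)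
  have hpk : G.Adj p k := Consec.adj hc ⟨A, R, rfl⟩
  have hpxy : p = x ∨ p = y := hN k hk p hp hpk.symm
  have hbR : b ∈ k :: R := List.mem_of_getLast? (last_eq_of_append (A := A ++ [p])
    (by simpa using hb) (by simp))
  have hkR : (k :: R).IsChain G.Adj := (hc.right_of_append).of_cons
  obtain ⟨Q, q, C, he, hQ, hq⟩ := exists_first_exit ⟨b, hbR, hbH⟩
  obtain ⟨s, hs, hsq⟩ := adj_of_first_exit hkR he hk hQ hq
  have hqxy : q = x ∨ q = y := hN s hs q hq hsq
  rw [he] at hn hb hbR hkR hHl hc ⊢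
  have hnd : p ∉ Q ++ q :: C := (List.nodup_cons.1 (List.nodup_append.1 hn).2.1).1
  have hpq : p ≠ q := by
    rintro rfl
    exact hnd (by simp)
  refine ⟨p, q, A, Q, C, by grind, rfl, fun v => ⟨hQ v, fun hv => ?_⟩⟩
  -- A second visit to `H` would need two further outer neighbours of `H`.
  by_contra hvQ
  have hvC : v ∈ q :: C := by
    have := hHl v hv
    simp only [List.mem_append, List.mem_cons] at this
    rcases this with h | rfl | h | rfl | h
    · exact absurd hv (hA v h)
    · exact absurd hv hp
    · exact absurd h hvQ
    · exact absurd hv hq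
    · exact List.mem_cons_of_mem _ h
  obtain ⟨A', p', k', R', he', -, hp', hk'⟩ := exists_first_entry ⟨v, hvC, hv⟩ (by
    intro a' ha'
    simp only [List.head?_cons, Option.some.injEq] at ha'
    exact ha' ▸ hq)
  have hCc : (q :: C).IsChain G.Adj := hkR.right_of_append
  have hbC : b ∈ k' :: R' := by
    rw [he'] at hb
    refine List.mem_of_getLast? (last_eq_of_append (A := A ++ p :: (Q ++ (A' ++ [p'])))
      ?_ (by simp))
    simpa using hb
  have hCn : (q :: C).Nodup := (List.nodup_append.1
    (List.nodup_cons.1 (List.nodup_append.1 hn).2.1).2).2.1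
  have hpC : p ∉ q :: C := fun h => hnd (List.mem_append_right _ h)
  rw [he'] at hCc hCn hpC
  have hpk' : G.Adj p' k' := Consec.adj hCc ⟨A', R', rfl⟩
  have hkR' : (k' :: R').IsChain G.Adj := (hCc.right_of_append).of_cons
  obtain ⟨Q', q', C', he2, hQ', hq'⟩ := exists_first_exit ⟨b, hbC, hbH⟩
  obtain ⟨s', hs', hsq'⟩ := adj_of_first_exit hkR' he2 hk' hQ' hq'
  have h1 := hN k' hk' p' hp' hpk'.symm
  have h2 := hN s' hs' q' hq' hsq'
  rw [he2] at hCn hpC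
  have h3 : p' ≠ q' := by
    rintro rfl
    exact (List.nodup_cons.1 (List.nodup_append.1 hCn).2.1).1 (by simp)
  have h4 : p ≠ p' := by rintro rfl; exact hpC (by simp)
  have h5 : p ≠ q' := by rintro rfl; exact hpC (by simp)
  grind

/-- The counting step for a path `…, z, x, H, y, w, …`: an independent set in `H'`, the successors
of attachment vertices of `H'` other than `x` and `z`, the first vertex of the path and a vertex of
`H` form an independent set. -/
lemma card_le_of_excursion {A₀ C₀ : List V} (hα : AlphaLE G Set.univ 4) (hm : MaxPath G l a b H')
    (hM : ∀ (T : Set V) (c : V), {x | x ∈ l} ⊆ T → T ⊆ {x | x ∈ l} ∪ H' → c ∈ H' → ¬ Span G T c b)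
    (hl : l = A₀ ++ z :: x :: (Q ++ y :: w :: C₀)) (hQ : ∀ v, v ∈ Q ↔ v ∈ H) (hh : h₀ ∈ H)
    (hN : ∀ a ∈ H, ∀ b ∉ H, G.Adj a b → b = x ∨ b = y) (ha : a ∉ H ∧ a ≠ x ∧ a ≠ y)
    {I N : Finset V} (hI : (I : Set V) ⊆ H') (hi : G.IsIndepSet (I : Set V))
    (hNN : ∀ n ∈ N, n ∈ l ∧ n ≠ b ∧ Touches G n H' ∧ n ≠ x ∧ n ≠ z) :
    I.card + N.card + 2 ≤ 4 := by
  classical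
  obtain ⟨J, h1, h2, h3⟩ := hm.exists_indep_head hM hI hi
    (fun n hn => ⟨(hNN n hn).1, (hNN n hn).2.1, (hNN n hn).2.2.1⟩)
  have hHl : ∀ k ∈ H, k ∈ l := fun k hk => by
    rw [hl]; simp [(hQ k).2 hk]
  have hxl : x ∈ l := by rw [hl]; simp
  have hyl : y ∈ l := by rw [hl]; simp
  have czx : Consec l z x := ⟨A₀, _, hl⟩
  have cyw : Consec l y w := ⟨A₀ ++ z :: x :: Q, C₀, by simp [hl]⟩
  have hQne : Q ≠ [] := by
    rintro rfl
    simpa using (hQ h₀).2 hh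
  obtain ⟨Q', q, rfl⟩ := Q.eq_nil_or_concat.resolve_left hQne
  have hq : q ∈ H := (hQ q).1 (by simp)
  have cqy : Consec l q y := ⟨A₀ ++ z :: x :: Q', w :: C₀, by simp [hl]⟩
  have hnd := hm.nodup
  have hwH : w ∉ H := by
    intro h
    have := (hQ w).2 h
    have hn : ((A₀ ++ z :: x :: Q'.concat q) ++ y :: w :: C₀).Nodup := by
      have : (A₀ ++ z :: x :: Q'.concat q) ++ y :: w :: C₀ = l := by simp [hl]
      rw [this]; exact hnd
    exact (List.nodup_append.1 hn).2.2 w (by simp; simp at this; tauto) w (by simp) rfl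
  have hnH : ∀ n ∈ l, Touches G n H' → n ∉ H := by
    rintro n hn ⟨k, hk, hnk⟩ hnH
    have hkl := hm.disj k hk
    rcases hN n hnH k (fun h => hkl (hHl k h)) hnk with rfl | rfl
    · exact hkl hxl
    · exact hkl hyl
  have hJ : ∀ v ∈ J, v ∉ H ∧ v ≠ x ∧ v ≠ y := by
    intro v hv
    rcases h3 v hv with rfl | hv | ⟨n, hn, hc⟩
    · exact ha
    · have hvl := hm.disj v hv
      exact ⟨fun h => hvl (hHl v h), fun e => hvl (e ▸ hxl), fun e => hvl (e ▸ hyl)⟩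
    · obtain ⟨k1, k2, k3, k4, k5⟩ := hNN n hn
      refine ⟨fun hvH => ?_, ?_, ?_⟩
      · rcases hN v hvH n (hnH n k1 k3) (hc.adj hm.chain).symm with rfl | rfl
        · exact k4 rfl
        · have : v = w := hc.reverse.left_unique (by simpa using hnd) cyw.reverse
          exact hwH (this ▸ hvH)
      · rintro rfl
        exact k5 (hc.left_unique hnd czx)
      · rintro rfl
        exact hnH n k1 k3 (hc.left_unique hnd cqy ▸ hq)
  have := hα (insert h₀ J) (Set.subset_univ _) (by
    have hadj : ∀ v ∈ J, ¬ G.Adj h₀ v := fun v hv hadj => by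
      obtain ⟨k1, k2, k3⟩ := hJ v hv
      rcases hN h₀ hh v k1 hadj with h | h
      · exact k2 h
      · exact k3 h
    intro s hs t ht hst
    simp only [Finset.coe_insert, Set.mem_insert_iff, Finset.mem_coe] at hs ht
    rcases hs with rfl | hs <;> rcases ht with rfl | ht
    · exact absurd rfl hst
    · exact hadj t ht
    · exact fun h => hadj s hs h.symm
    · exact h2 hs ht hst)
  rw [Finset.card_insert_of_notMem (fun h => (hJ _ h).1 hh), h1] at this
  omega

end

/-! ### Graphs without cut vertices -/

section

variable {V : Type*} {G : SimpleGraph V} {H : Set V} {l Q : List V} {a b x y z w : V}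

/-- Let a path run through the clique `H` in the order `x, H, y`, such that its vertex set is
maximal among the paths containing `H` with ends outside `H ∪ {x, y}`. If it is not Hamiltonian,
any component `H'` of the rest is a clique with two outer neighbours, one of them `x` or its
predecessor `z`, the other `y` or its successor `w`. -/
lemma span_of_maximal_excursion [Finite V] (hG : ConnOn G Set.univ) (hα : AlphaLE G Set.univ 4)
    (h2 : ∀ w, ¬ HasParts G {w} 2) (h4 : ∀ x y, x ≠ y → ¬ HasParts G {x, y} 4)
    (hH : H.Nonempty) (hHc : G.IsClique H) (hx : x ∉ H) (hy : y ∉ H)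
    (hN : ∀ a ∈ H, ∀ b ∉ H, G.Adj a b → b = x ∨ b = y)
    {A₀ C₀ : List V} (hl : l = A₀ ++ z :: x :: (Q ++ y :: w :: C₀)) (hQ : ∀ v, v ∈ Q ↔ v ∈ H)
    (hc : l.IsChain G.Adj) (hn : l.Nodup) (ha : l.head? = some a) (hb : l.getLast? = some b)
    (haH : a ∉ H ∧ a ≠ x ∧ a ≠ y) (hbH : b ∉ H ∧ b ≠ x ∧ b ≠ y)
    (hmax : ∀ T a b, {v | v ∈ l} ⊆ T → Span G T a b → (a ∉ H ∧ a ≠ x ∧ a ≠ y) →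
      (b ∉ H ∧ b ≠ x ∧ b ≠ y) → T ⊆ {v | v ∈ l}) :
    ∃ u v, Span G Set.univ u v := by
  classical
  by_cases hall : ∀ v, v ∈ l
  · exact ⟨a, b, l, hc, hn, ha, hb, fun v => by simp [hall]⟩
  push Not at hall
  obtain ⟨u, hu⟩ := hall
  obtain ⟨H', hH'l, huH', hH', hcl⟩ := exists_component (S := {v | v ∉ l}) (v := u) G hu
  have hdis : ∀ v ∈ H', v ∉ l := fun v hv => hH'l hv
  have hHl : ∀ k ∈ H, k ∈ l := fun k hk => by
    rw [hl]; simp [(hQ k).2 hk]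
  have hxl : x ∈ l := by rw [hl]; simp
  have hyl : y ∈ l := by rw [hl]; simp
  have hzl : z ∈ l := by rw [hl]; simp
  have hwl : w ∈ l := by rw [hl]; simp
  have hout : ∀ c ∈ H', c ∉ H ∧ c ≠ x ∧ c ≠ y := fun c hc =>
    ⟨fun h => hdis c hc (hHl c h), fun e => hdis c hc (e ▸ hxl), fun e => hdis c hc (e ▸ hyl)⟩
  have hm : MaxPath G l a b H' :=
    ⟨hc, hn, ha, hb, hH', hdis, fun T hT _ hs => hmax T a b hT hs haH hbH⟩
  have hM : ∀ (T : Set V) (c : V), {x | x ∈ l} ⊆ T → T ⊆ {x | x ∈ l} ∪ H' → c ∈ H' →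
      ¬ Span G T c b := fun T c hT _ hc hs =>
    hdis c hc (hmax T c b hT hs (hout c hc) hbH hs.left_mem)
  have hM' : ∀ (T : Set V) (c : V), {x | x ∈ l.reverse} ⊆ T → T ⊆ {x | x ∈ l.reverse} ∪ H' →
      c ∈ H' → ¬ Span G T c a := by
    intro T c hT _ hc hs
    simp only [List.mem_reverse] at hT
    exact hdis c hc (hmax T c a hT hs (hout c hc) haH hs.left_mem)
  have hl' : l.reverse = C₀.reverse ++ w :: y :: (Q.reverse ++ x :: z :: A₀.reverse) := by
    simp [hl]
  have hQ' : ∀ v, v ∈ Q.reverse ↔ v ∈ H := by simpa using hQ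
  have haT : ¬ Touches G a H' := hm.not_touches_head hM
  have hbT : ¬ Touches G b H' := hm.reverse.not_touches_head hM'
  have hTl : ∀ n ∉ H', Touches G n H' → n ∈ l := by
    rintro n hn ⟨k, hk, hnk⟩
    by_contra h
    exact hn (hcl k hk n h hnk.symm)
  have hHT : ∀ n ∈ H, ¬ Touches G n H' := by
    rintro n hn ⟨k, hk, hnk⟩
    obtain ⟨k1, k2, k3⟩ := hout k hk
    rcases hN n hn k k1 hnk with h | h
    · exact k2 h
    · exact k3 h
  obtain ⟨h₀, hh₀⟩ := hH
  have fwd : ∀ (I N : Finset V), (I : Set V) ⊆ H' → G.IsIndepSet (I : Set V) →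
      (∀ n ∈ N, n ∉ H' ∧ Touches G n H' ∧ n ≠ x ∧ n ≠ z) → I.card + N.card ≤ 2 := by
    intro I N hI hi hNN
    have := card_le_of_excursion hα hm hM hl hQ hh₀ hN haH hI hi (N := N) fun n hn => by
      obtain ⟨k1, k2, k3, k4⟩ := hNN n hn
      exact ⟨hTl n k1 k2, fun e => hbT (e ▸ k2), k2, k3, k4⟩
    omega
  have bwd : ∀ (I N : Finset V), (I : Set V) ⊆ H' → G.IsIndepSet (I : Set V) →
      (∀ n ∈ N, n ∉ H' ∧ Touches G n H' ∧ n ≠ y ∧ n ≠ w) → I.card + N.card ≤ 2 := by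
    intro I N hI hi hNN
    have := card_le_of_excursion hα hm.reverse hM' hl' hQ' hh₀
      (fun a ha b hb hab => (hN a ha b hb hab).symm) ⟨hbH.1, hbH.2.2, hbH.2.1⟩ hI hi (N := N)
      fun n hn => by
        obtain ⟨k1, k2, k3, k4⟩ := hNN n hn
        exact ⟨by simpa using hTl n k1 k2, fun e => haT (e ▸ k2), k2, k3, k4⟩
    omega
  have huI : ((({u} : Finset V)) : Set V) ⊆ H' := by simpa using huH'
  have fwd2 : ∀ n m, n ∉ H' → m ∉ H' → Touches G n H' → Touches G m H' → n ≠ x → n ≠ z →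
      m ≠ x → m ≠ z → n = m := by
    intro n m k1 k2 k3 k4 k5 k6 k7 k8
    by_contra hnm
    have := fwd {u} {n, m} huI (by simp) (by
      intro k hk
      simp only [Finset.mem_insert, Finset.mem_singleton] at hk
      rcases hk with rfl | rfl
      · exact ⟨k1, k3, k5, k6⟩
      · exact ⟨k2, k4, k7, k8⟩)
    rw [Finset.card_pair hnm] at this
    simp at this
  have bwd2 : ∀ n m, n ∉ H' → m ∉ H' → Touches G n H' → Touches G m H' → n ≠ y → n ≠ w →
      m ≠ y → m ≠ w → n = m := by
    intro n m k1 k2 k3 k4 k5 k6 k7 k8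
    by_contra hnm
    have := bwd {u} {n, m} huI (by simp) (by
      intro k hk
      simp only [Finset.mem_insert, Finset.mem_singleton] at hk
      rcases hk with rfl | rfl
      · exact ⟨k1, k3, k5, k6⟩
      · exact ⟨k2, k4, k7, k8⟩)
    rw [Finset.card_pair hnm] at this
    simp at this
  have czx : Consec l z x := ⟨A₀, _, hl⟩
  have cyw : Consec l y w := ⟨A₀ ++ z :: x :: Q, C₀, by simp [hl]⟩
  have hzx : ¬ (Touches G z H' ∧ Touches G x H') := fun h => hm.not_touches_succ czx h.1 h.2
  have hyw : ¬ (Touches G y H' ∧ Touches G w H') := fun h => hm.not_touches_succ cyw h.1 h.2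
  have hnd : [x, y, z, w].Nodup ∧ z ∉ H ∧ w ∉ H := by
    have hn' := hn
    rw [hl] at hn'
    have hz : z ∉ Q := by
      have := (List.nodup_cons.1 (List.nodup_append.1 hn').2.1).1
      intro h; exact this (by simp [h])
    have hw : w ∉ Q := by
      have := (List.nodup_append.1 (List.nodup_cons.1 (List.nodup_cons.1
        (List.nodup_append.1 hn').2.1).2).2).2.2
      intro h; exact this w h w (by simp) rfl
    refine ⟨?_, fun h => hz ((hQ z).2 h), fun h => hw ((hQ w).2 h)⟩
    have hsub : [z, x, y, w].Sublist l := by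
      rw [hl]
      refine List.Sublist.trans ?_ (List.sublist_append_right _ _)
      refine (List.Sublist.trans ?_ (List.sublist_append_right _ _)).cons_cons _ |>.cons_cons _
      simp
    have := hn.sublist hsub
    simp at this ⊢
    grind
  obtain ⟨hnd, hzH, hwH⟩ := hnd
  have hd' : (x ≠ y ∧ x ≠ z ∧ x ≠ w) ∧ (y ≠ z ∧ y ≠ w) ∧ z ≠ w := by simpa using hnd
  obtain ⟨⟨dxy, dxz, dxw⟩, ⟨dyz, dyw⟩, dzw⟩ := hd'
  have hxH' : x ∉ H' := fun h => hdis x h hxl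
  have hyH' : y ∉ H' := fun h => hdis y h hyl
  have hzH' : z ∉ H' := fun h => hdis z h hzl
  have hwH' : w ∉ H' := fun h => hdis w h hwl
  have haH' : a ∉ H' := fun h => hdis a h (List.mem_of_head? ha)
  have hbH' : b ∉ H' := fun h => hdis b h (List.mem_of_getLast? hb)
  -- Since `x` is not a cut vertex, `H'` has at least two outer neighbours.
  obtain ⟨n₁, hn₁, n₂, hn₂, hne, t₁, t₂⟩ : ∃ n₁ ∉ H', ∃ n₂ ∉ H', n₂ ≠ n₁ ∧ Touches G n₁ H' ∧
      Touches G n₂ H' := by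
    obtain ⟨k, hk, n₁, -, hn₁, hkn⟩ := hG.exists_adj (Set.subset_univ H') ⟨u, huH'⟩
      (Set.mem_univ x) hxH'
    obtain ⟨n₂, hn₂, hne, t₂⟩ := exists_touches_ne h2 ⟨u, huH'⟩ hn₁ haH'
      (fun e => haT (e ▸ .of_adj hk hkn))
    exact ⟨n₁, hn₁, n₂, hn₂, hne, .of_adj hk hkn, t₂⟩
  have hq : ∃ q, (q = y ∨ q = w) ∧ Touches G q H' := by
    by_contra! hcon
    exact hne (bwd2 n₂ n₁ hn₂ hn₁ t₂ t₁ (fun e => hcon _ (Or.inl e) t₂)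
      (fun e => hcon _ (Or.inr e) t₂) (fun e => hcon _ (Or.inl e) t₁)
      (fun e => hcon _ (Or.inr e) t₁))
  have hp : ∃ p, (p = x ∨ p = z) ∧ Touches G p H' := by
    by_contra! hcon
    exact hne (fwd2 n₂ n₁ hn₂ hn₁ t₂ t₁ (fun e => hcon _ (Or.inl e) t₂)
      (fun e => hcon _ (Or.inr e) t₂) (fun e => hcon _ (Or.inl e) t₁)
      (fun e => hcon _ (Or.inr e) t₁))
  obtain ⟨q, hq, tq⟩ := hq
  obtain ⟨p, hp, tp⟩ := hp
  have hqn : q ∉ H' ∧ q ≠ x ∧ q ≠ z := by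
    rcases hq with rfl | rfl
    · exact ⟨hyH', dxy.symm, dyz⟩
    · exact ⟨hwH', dxw.symm, dzw.symm⟩
  have hNT : ∀ n ∉ H', Touches G n H' → n = p ∨ n = q := by
    intro n hn ht
    by_cases h5 : n = x
    · subst h5
      rcases hp with rfl | rfl
      · exact Or.inl rfl
      · exact absurd ⟨tp, ht⟩ hzx
    by_cases h6 : n = z
    · subst h6
      rcases hp with rfl | rfl
      · exact absurd ⟨ht, tp⟩ hzx
      · exact Or.inl rfl
    exact Or.inr (fwd2 n q hn hqn.1 ht tq h5 h6 hqn.2.1 hqn.2.2)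
  have hN' : ∀ a ∈ H', ∀ b ∉ H', G.Adj a b → b = p ∨ b = q :=
    fun a ha b hb hab => hNT b hb (.of_adj ha hab)
  have hHc' : G.IsClique H' := alphaLE_one_iff.1 fun I hI hi => by
    have := fwd I {q} hI hi (by
      intro n hn
      rw [Finset.mem_singleton.1 hn]
      exact ⟨hqn.1, tq, hqn.2⟩)
    simp at this
    omega
  have hHH : Anticomplete G H H' :=
    ⟨fun k hk hk' => (hout k hk').1 hk, fun k hk k' hk' hkk => hHT k hk ⟨k', hk', hkk⟩⟩
  have azx : G.Adj z x := czx.adj hc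
  have ayw : G.Adj y w := cyw.adj hc
  rcases hp with rfl | rfl <;> rcases hq with rfl | rfl
  · exact span_of_two_attached (x := p) (y := q) (v := a) hG hα h2 h4 dxy ⟨h₀, hh₀⟩ ⟨u, huH'⟩ hx hy
      hxH' hyH' hHH (fun b hb ⟨k, hk, hbk⟩ => hN k hk b hb hbk.symm) hNT
      ⟨haH.2.1, haH.2.2, haH.1, haH'⟩
  · exact span_of_cliques_common (x := y) (y := p) (z := q) (v := b) hG hα h2 h4 dxy.symm dyw dxw
      ayw ⟨h₀, hh₀⟩ hHc ⟨u, huH'⟩ hHc' ⟨hy, hyH'⟩ ⟨hx, hxH'⟩ ⟨hwH, hwH'⟩ hHH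
      (fun k hk b hb hkb => (hN k hk b hb hkb).symm)
      (fun k hk b hb hkb => (hN' k hk b hb hkb).symm)
      ⟨hbH.2.2, hbH.2.1, fun e => hbT (e ▸ tq), hbH.1, hbH'⟩
  · exact span_of_cliques_common (x := x) (y := q) (z := p) (v := a) hG hα h2 h4 dxy dxz dyz
      azx.symm ⟨h₀, hh₀⟩ hHc ⟨u, huH'⟩ hHc' ⟨hx, hxH'⟩ ⟨hy, hyH'⟩ ⟨hzH, hzH'⟩ hHH hN hN'
      ⟨haH.2.1, haH.2.2, fun e => haT (e ▸ tp), haH.1, haH'⟩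
  · exact span_of_cliques_disjoint (x := x) (y := y) (z := p) (w := q) (v := a) hG hα h2 h4 hnd
      azx.symm ayw ⟨h₀, hh₀⟩ hHc ⟨u, huH'⟩ hHc' ⟨hx, hxH'⟩ ⟨hy, hyH'⟩ ⟨hzH, hzH'⟩ ⟨hwH, hwH'⟩ hHH
      hN hN' ⟨haH.2.1, haH.2.2, fun e => haT (e ▸ tp), fun e => haT (e ▸ tq), haH.1, haH'⟩

/-- If some path with ends outside `H ∪ {x, y}` contains the clique `H`, whose outer neighbours are
`x` and `y`, then there is a Hamiltonian path. -/
lemma span_of_excursion [Finite V] (hG : ConnOn G Set.univ) (hα : AlphaLE G Set.univ 4)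
    (h2 : ∀ w, ¬ HasParts G {w} 2) (h4 : ∀ x y, x ≠ y → ¬ HasParts G {x, y} 4)
    (hH : H.Nonempty) (hHc : G.IsClique H) (hx : x ∉ H) (hy : y ∉ H)
    (hN : ∀ a ∈ H, ∀ b ∉ H, G.Adj a b → b = x ∨ b = y)
    (hex : ∃ P a b, Span G P a b ∧ H ⊆ P ∧ (a ∉ H ∧ a ≠ x ∧ a ≠ y) ∧ (b ∉ H ∧ b ≠ x ∧ b ≠ y)) :
    ∃ u v, Span G Set.univ u v := by
  let F : Set (Set V) := {P | ∃ a b, Span G P a b ∧ H ⊆ P ∧ (a ∉ H ∧ a ≠ x ∧ a ≠ y) ∧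
    (b ∉ H ∧ b ≠ x ∧ b ≠ y)}
  obtain ⟨P, ⟨a, b, hP, hHP, ha, hb⟩, hmax⟩ := F.toFinite.exists_maximal hex
  obtain ⟨l, hc, hn, hla, hlb, hlP⟩ := hP
  have hPl : {v | v ∈ l} = P := Set.ext hlP
  have hmax' : ∀ T a b, {v | v ∈ l} ⊆ T → Span G T a b → (a ∉ H ∧ a ≠ x ∧ a ≠ y) →
      (b ∉ H ∧ b ≠ x ∧ b ≠ y) → T ⊆ {v | v ∈ l} := by
    intro T a b hT hs ha hb
    rw [hPl] at hT ⊢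
    exact hmax ⟨a, b, hs, hHP.trans hT, ha, hb⟩ hT
  obtain ⟨p, q, A, Q, C, hpq, hl, hQ⟩ := exists_excursion hc hn hla ha.1 hlb hb.1 hH
    (fun h hh => (hlP h).2 (hHP hh)) hN
  have hA : A ≠ [] := by
    rintro rfl
    rw [hl] at hla
    simp only [List.nil_append, List.head?_cons, Option.some.injEq] at hla
    grind
  have hC : C ≠ [] := by
    rintro rfl
    have e : l = (A ++ p :: Q) ++ [q] := by simp [hl]
    rw [e, List.getLast?_append] at hlb
    simp at hlb
    grind
  obtain ⟨A, z, rfl⟩ := A.eq_nil_or_concat.resolve_left hA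
  obtain ⟨w, C, rfl⟩ := List.exists_cons_of_ne_nil hC
  have hl' : l = A ++ z :: p :: (Q ++ q :: w :: C) := by simp [hl]
  rcases hpq with ⟨rfl, rfl⟩ | ⟨rfl, rfl⟩
  · exact span_of_maximal_excursion hG hα h2 h4 hH hHc hx hy hN hl' hQ hc hn hla hlb ha hb hmax'
  · exact span_of_maximal_excursion hG hα h2 h4 hH hHc hy hx
      (fun a ha b hb hab => (hN a ha b hb hab).symm) hl' hQ hc hn hla hlb (by tauto) (by tauto)
      (fun T a b hT hs ha hb => hmax' T a b hT hs (by tauto) (by tauto))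

/-- Hamiltonian paths for graphs without cut vertices: a component `H` of the complement of a
maximal path has two attachment vertices, since their successors, the first vertex of the path and
a vertex of `H` are independent; and replacing the part of the path between these two by `H` gives a
path to which `span_of_excursion` applies. -/
lemma exists_span_of_no_cutVertex [Finite V] [Nonempty V] (hG : ConnOn G Set.univ)
    (hα : AlphaLE G Set.univ 4) (h2 : ∀ w, ¬ HasParts G {w} 2)
    (h4 : ∀ x y, x ≠ y → ¬ HasParts G {x, y} 4) : ∃ u v, Span G Set.univ u v := by
  classical
  let F : Set (Set V) := {P | ∃ a b, Span G P a b}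
  obtain ⟨v₀⟩ := ‹Nonempty V›
  obtain ⟨P, ⟨a, b, hP⟩, hmax⟩ := F.toFinite.exists_maximal ⟨{v₀}, v₀, v₀, Span.singleton G v₀⟩
  obtain ⟨l, hc, hn, hla, hlb, hlP⟩ := hP
  have hPl : {v | v ∈ l} = P := Set.ext hlP
  by_cases hall : ∀ v, v ∈ l
  · exact ⟨a, b, l, hc, hn, hla, hlb, fun v => by simp [hall]⟩
  push Not at hall
  obtain ⟨u, hu⟩ := hall
  obtain ⟨H, hHl, huH, hH, hcl⟩ := exists_component (S := {v | v ∉ l}) (v := u) G hu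
  have hdis : ∀ v ∈ H, v ∉ l := fun v hv => hHl hv
  have hmax' : ∀ T a b, {v | v ∈ l} ⊆ T → Span G T a b → T ⊆ {v | v ∈ l} := by
    intro T a b hT hs
    rw [hPl] at hT ⊢
    exact hmax ⟨a, b, hs⟩ hT
  have hm : MaxPath G l a b H := ⟨hc, hn, hla, hlb, hH, hdis, fun T hT _ hs => hmax' T a b hT hs⟩
  have hM : ∀ (T : Set V) (c : V), {x | x ∈ l} ⊆ T → T ⊆ {x | x ∈ l} ∪ H → c ∈ H →
      ¬ Span G T c b := fun T c hT _ hc hs => hdis c hc (hmax' T c b hT hs hs.left_mem)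
  have haT : ¬ Touches G a H := hm.not_touches_head hM
  have hbT : ¬ Touches G b H := by
    refine hm.reverse.not_touches_head fun T c hT _ hc hs => ?_
    simp only [List.mem_reverse] at hT
    exact hdis c hc (hmax' T c a hT hs hs.left_mem)
  have hal : a ∈ l := List.mem_of_head? hla
  have hbl : b ∈ l := List.mem_of_getLast? hlb
  have haH : a ∉ H := fun h => hdis a h hal
  have hbH : b ∉ H := fun h => hdis b h hbl
  have hTl : ∀ n ∉ H, Touches G n H → n ∈ l := by
    rintro n hn ⟨k, hk, hnk⟩
    by_contra h
    exact hn (hcl k hk n h hnk.symm)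
  have hcount : ∀ I N : Finset V, (I : Set V) ⊆ H → G.IsIndepSet (I : Set V) →
      (∀ n ∈ N, n ∉ H ∧ Touches G n H) → I.card + N.card ≤ 3 := by
    intro I N hI hi hN
    obtain ⟨J, hJ, hJi, -⟩ := hm.exists_indep_head hM hI hi (N := N) fun n hn =>
      ⟨hTl n (hN n hn).1 (hN n hn).2, fun e => hbT (e ▸ (hN n hn).2), (hN n hn).2⟩
    have := hα J (Set.subset_univ _) hJi
    omega
  obtain ⟨k, hk, x, -, hxH, hkx⟩ := hG.exists_adj (Set.subset_univ H) ⟨u, huH⟩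
    (Set.mem_univ a) haH
  have tx : Touches G x H := .of_adj hk hkx
  obtain ⟨y, hyH, hyx, ty⟩ := exists_touches_ne h2 ⟨u, huH⟩ hxH haH (fun e => haT (e ▸ tx))
  have hN : ∀ c ∈ H, ∀ d ∉ H, G.Adj c d → d = x ∨ d = y := by
    intro c hc d hd hcd
    by_contra! hne
    have := hcount {u} {x, y, d} (by simpa using huH) (by simp) (by
      intro n hn
      simp only [Finset.mem_insert, Finset.mem_singleton] at hn
      rcases hn with rfl | rfl | rfl
      · exact ⟨hxH, tx⟩
      · exact ⟨hyH, ty⟩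
      · exact ⟨hd, .of_adj hc hcd⟩)
    rw [Finset.card_eq_three.2 ⟨x, y, d, hyx.symm, hne.1.symm, hne.2.symm, rfl⟩] at this
    simp at this
  have hHc : G.IsClique H := alphaLE_one_iff.1 fun I hI hi => by
    have := hcount I {x, y} hI hi (by
      intro n hn
      simp only [Finset.mem_insert, Finset.mem_singleton] at hn
      rcases hn with rfl | rfl
      · exact ⟨hxH, tx⟩
      · exact ⟨hyH, ty⟩)
    rw [Finset.card_pair hyx.symm] at this
    omega
  -- The roles of `x` and `y` are symmetric; let `p` be the first of them on the path.
  obtain ⟨p, q, A, B, C, hpq, hl⟩ : ∃ p q A B C, ((p = x ∧ q = y) ∨ (p = y ∧ q = x)) ∧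
      l = A ++ p :: (B ++ q :: C) := by
    obtain ⟨A, B, hAB⟩ := List.append_of_mem (hTl x hxH tx)
    have hy := hTl y hyH ty
    rw [hAB] at hy
    simp only [List.mem_append, List.mem_cons] at hy
    rcases hy with hy | hy | hy
    · obtain ⟨C, D, rfl⟩ := List.append_of_mem hy
      exact ⟨y, x, C, D, B, Or.inr ⟨rfl, rfl⟩, by simp [hAB]⟩
    · exact absurd hy hyx
    · obtain ⟨C, D, rfl⟩ := List.append_of_mem hy
      exact ⟨x, y, A, C, D, Or.inl ⟨rfl, rfl⟩, by simp [hAB]⟩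
  have hax : a ≠ x := fun e => haT (e ▸ tx)
  have hay : a ≠ y := fun e => haT (e ▸ ty)
  have hbx : b ≠ x := fun e => hbT (e ▸ tx)
  have hby : b ≠ y := fun e => hbT (e ▸ ty)
  refine span_of_excursion hG hα h2 h4 ⟨u, huH⟩ hHc hxH hyH hN ?_
  have hN' : ∀ c ∈ H, ∀ d ∉ H, G.Adj c d → d = p ∨ d = q := by
    intro c hc d hd hcd
    have := hN c hc d hd hcd
    rcases hpq with ⟨rfl, rfl⟩ | ⟨rfl, rfl⟩
    · exact this
    · exact this.symm
  have hpqH : p ∉ H ∧ q ∉ H ∧ p ≠ q ∧ a ≠ p ∧ b ≠ q := by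
    rcases hpq with ⟨rfl, rfl⟩ | ⟨rfl, rfl⟩
    · exact ⟨hxH, hyH, hyx.symm, hax, hby⟩
    · exact ⟨hyH, hxH, hyx, hay, hbx⟩
  obtain ⟨hpH, hqH, hpq', hap, hbq⟩ := hpqH
  obtain ⟨s, hs, t, ht, hps, hqt, hst⟩ :=
    exists_span_of_two_neighbors h2 ⟨u, huH⟩ hHc hpH hqH hpq' hN'
  have e : l = (A ++ [p]) ++ (B ++ q :: C) := by simp [hl]
  have hd := (List.nodup_append.1 (e ▸ hn)).2.2
  have s1 : Span G {v | v ∈ A ++ [p]} a p := span_of_list (e ▸ hc).left_of_append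
    (List.nodup_append.1 (e ▸ hn)).1 (head_eq_of_append (e ▸ hla) (by simp)) (by simp)
  have s2 : Span G {v | v ∈ q :: C} q b := span_of_list (e ▸ hc).right_of_append.right_of_append
    (List.nodup_append.1 (List.nodup_append.1 (e ▸ hn)).2.1).2.1 (by simp)
    (last_eq_of_append (last_eq_of_append (e ▸ hlb) (by simp)) (by simp))
  have hd1 : ∀ v ∈ A ++ [p], v ∈ l := fun v hv => by rw [e]; exact List.mem_append_left _ hv
  have hd2 : ∀ v ∈ q :: C, v ∈ l := fun v hv => by
    rw [e]; exact List.mem_append_right _ (List.mem_append_right _ hv)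
  have t1 := s1.append hst (Set.disjoint_left.2 fun v hv hvH => hdis v hvH (hd1 v hv)) hps
  have t2 := t1.append s2 (Set.disjoint_left.2 (by
    rintro v (hv | hv) hv'
    · exact hd v hv v (List.mem_append_right _ hv') rfl
    · exact hdis v hv (hd2 v hv'))) hqt.symm
  exact ⟨_, a, b, t2, fun v hv => Or.inl (Or.inr hv), ⟨haH, hax, hay⟩, ⟨hbH, hbx, hby⟩⟩

end

/-! ### Translation from and to walks, components and connectivity -/

section

variable {V : Type*} {G : SimpleGraph V} {X Q Q₁ Q₂ : Set V} {x u v w : V} {k : ℕ}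

lemma hasHamiltonianPathFrom_iff : HasHamiltonianPathFrom G u ↔ ∃ v, Span G Set.univ u v := by
  classical
  constructor
  · rintro ⟨v, p, hp⟩
    have hp : p.IsHamiltonian := by convert hp
    refine ⟨v, p.support, p.isChain_adj_support, hp.isPath.support_nodup, ?_, ?_, ?_⟩
    · rw [List.head?_eq_some_head p.support_ne_nil, p.head_support]
    · rw [List.getLast?_eq_some_getLast p.support_ne_nil, p.getLast_support]
    · intro x
      simp [hp.mem_support]
  · rintro ⟨v, l, h1, h2, h3, h4, h5⟩
    have hne : l ≠ [] := by rintro rfl; simp at h3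
    have hu : l.head hne = u := by
      rw [List.head?_eq_some_head hne] at h3; simpa using h3
    subst hu
    refine ⟨_, SimpleGraph.Walk.ofSupport l hne h1, ?_⟩
    intro x
    rw [SimpleGraph.Walk.support_ofSupport]
    convert List.count_eq_one_of_mem h2 ((h5 x).2 (Set.mem_univ x))

lemma hasHamiltonianPath_iff : HasHamiltonianPath G ↔ ∃ u v, Span G Set.univ u v :=
  exists_congr fun _ => hasHamiltonianPathFrom_iff

lemma hasHamiltonianPathFrom_induce_iff {u : Q} :
    HasHamiltonianPathFrom (G.induce Q) u ↔ ∃ v, Span G Q u v := by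
  rw [hasHamiltonianPathFrom_iff]
  constructor
  · rintro ⟨v, l, h1, h2, h3, h4, h5⟩
    refine ⟨v, l.map Subtype.val, ?_, h2.map Subtype.val_injective, by rw [List.head?_map, h3]; rfl,
      by rw [List.getLast?_map, h4]; rfl, ?_⟩
    · rw [List.isChain_map]
      exact h1
    · intro x
      simp only [List.mem_map, Subtype.exists, exists_and_right, exists_eq_right]
      exact ⟨fun ⟨h, _⟩ => h, fun h => ⟨h, (h5 _).2 trivial⟩⟩
  · rintro ⟨v, l, h1, h2, h3, h4, h5⟩
    have hmem : ∀ x ∈ l, x ∈ Q := fun x hx => (h5 x).1 hx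
    refine ⟨⟨v, hmem v (List.mem_of_getLast? h4)⟩, l.attachWith (· ∈ Q) hmem, ?_, ?_, ?_, ?_, ?_⟩
    · have e : (l.attachWith (· ∈ Q) hmem).map Subtype.val = l := by simp
      rw [← e, List.isChain_map] at h1
      exact h1
    · refine List.Nodup.of_map Subtype.val ?_
      simpa using h2
    · cases l with
      | nil => simp at h3
      | cons a l => simp at h3; simp [h3]
    · rw [List.getLast?_attachWith]
      simp [h4]
    · intro x
      simp [h5]

lemma alphaLE_of_isEdgelessFree (h : IsEdgelessFree (k + 1) G) : AlphaLE G Set.univ k := by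
  intro I _ hI
  by_contra hk
  push Not at hk
  obtain ⟨J, hJ, hc⟩ := Finset.exists_subset_card_eq (Nat.succ_le_of_lt hk)
  let e := (J.equivFinOfCardEq hc).symm
  refine h ⟨⟨⟨fun i => (e i : V), fun i j hij => e.injective (Subtype.ext hij)⟩, ?_⟩⟩
  intro i j
  simp only [SimpleGraph.bot_adj, iff_false]
  change ¬ G.Adj (e i : V) (e j : V)
  by_cases hij : (e i : V) = e j
  · rw [hij]; exact G.loopless.irrefl _
  · exact hI (hJ (e i).2) (hJ (e j).2) hij

lemma isEdgelessFree_of_alphaLE (h : AlphaLE G Q k) : IsEdgelessFree (k + 1) (G.induce Q) := by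
  classical
  rintro ⟨f⟩
  let g : Fin (k + 1) ↪ V := f.toEmbedding.trans (Function.Embedding.subtype _)
  have := h (Finset.univ.map g) (by
    intro x hx
    simp only [Finset.coe_map, Finset.coe_univ, Set.image_univ, Set.mem_range] at hx
    obtain ⟨i, rfl⟩ := hx
    exact (f i).2) (by
    intro x hx y hy hxy
    simp only [Finset.coe_map, Finset.coe_univ, Set.image_univ, Set.mem_range] at hx hy
    obtain ⟨i, rfl⟩ := hx
    obtain ⟨j, rfl⟩ := hy
    intro hadj
    have : (G.induce Q).Adj (f i) (f j) := hadj
    exact (f.map_adj_iff.1 this).elim)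
  simp at this

lemma HasParts.le_numComponents [Finite V] (h : HasParts G X k) :
    k ≤ numComponents (deleteVerts G X) := by
  obtain ⟨f, h1, h2⟩ := h
  let F : (deleteVerts G X).ConnectedComponent → Fin k :=
    SimpleGraph.ConnectedComponent.lift (fun v => f v) (by
      intro v w p _
      induction p with
      | nil => rfl
      | @cons a b c hab p ih => exact (h2 a a.2 b b.2 hab).trans (ih (by simp_all)))
  have hF : Function.Surjective F := by
    intro i
    obtain ⟨v, hv, rfl⟩ := h1 i
    exact ⟨(deleteVerts G X).connectedComponentMk ⟨v, hv⟩, rfl⟩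
  have := Nat.card_le_card_of_surjective F hF
  simpa [numComponents] using this

lemma isVertexCut_iff_hasParts : IsVertexCut G X ↔ HasParts G X 2 := by
  constructor
  · intro h
    unfold IsVertexCut SimpleGraph.Preconnected at h
    push Not at h
    obtain ⟨u, v, huv⟩ := h
    refine hasParts_two (A := {w | ∃ hw : w ∉ X, (deleteVerts G X).Reachable u ⟨w, hw⟩})
      (B := {w | ∃ hw : w ∉ X, ¬ (deleteVerts G X).Reachable u ⟨w, hw⟩})
      ⟨u, u.2, SimpleGraph.Reachable.refl _⟩ ⟨v, v.2, huv⟩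
      (fun w hw => ⟨fun h => h.1 hw, fun h => h.1 hw⟩) ?_ ⟨?_, ?_⟩
    · intro w hw
      by_cases h : (deleteVerts G X).Reachable u ⟨w, hw⟩
      · exact Or.inl ⟨hw, h⟩
      · exact Or.inr ⟨hw, h⟩
    · rintro w ⟨_, h⟩ ⟨_, h'⟩
      exact h' h
    · rintro a ⟨ha, h⟩ b ⟨hb, h'⟩ hab
      have : (deleteVerts G X).Adj ⟨a, ha⟩ ⟨b, hb⟩ := hab
      exact h' (h.trans this.reachable)
  · rintro ⟨f, h1, h2⟩ hpre
    obtain ⟨a, ha, ha'⟩ := h1 0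
    obtain ⟨b, hb, hb'⟩ := h1 1
    obtain ⟨p⟩ := hpre ⟨a, ha⟩ ⟨b, hb⟩
    have key : ∀ {s t : ↥(Xᶜ)}, (deleteVerts G X).Walk s t → f s = f t := by
      intro s t p
      induction p with
      | nil => rfl
      | @cons a b c hab p ih => exact (h2 a a.2 b b.2 hab).trans ih
    have := key p
    simp only [ha', hb'] at this
    exact absurd this (by decide)

lemma connOn_univ (h : G.Connected) : ConnOn G Set.univ := by
  rintro T - ⟨t, ht⟩ hcl v -
  obtain ⟨p⟩ := h.preconnected t v
  induction p with
  | nil => exact ht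
  | cons hab p ih => exact ih (hcl _ ht _ (Set.mem_univ _) hab)

lemma ne_top_of_isVertexCut (h : IsVertexCut G X) : G ≠ ⊤ := by
  rintro rfl
  refine h fun u v => ?_
  by_cases huv : u = v
  · rw [huv]
  · exact SimpleGraph.Adj.reachable (show (⊤ : SimpleGraph V).Adj u v from
      fun e => huv (Subtype.ext e))

lemma not_isVertexConnected [Finite V] (h : IsVertexCut G X) (hk : X.ncard < k) :
    ¬ IsVertexConnected k G := by
  unfold IsVertexConnected vertexConnectivity
  rw [if_neg (ne_top_of_isVertexCut h)]
  have := Nat.sInf_le (s := {n | ∃ A : Set V, IsVertexCut G A ∧ A.ncard = n}) ⟨X, h, rfl⟩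
  omega

lemma isVertexConnected_of_isVertexCut (h : IsVertexCut G X)
    (hk : ∀ A, IsVertexCut G A → k ≤ A.ncard) : IsVertexConnected k G := by
  unfold IsVertexConnected vertexConnectivity
  rw [if_neg (ne_top_of_isVertexCut h)]
  obtain ⟨A, hA, hA'⟩ := Nat.sInf_mem (s := {n | ∃ A : Set V, IsVertexCut G A ∧ A.ncard = n})
    ⟨_, X, h, rfl⟩
  rw [← hA']
  exact hk A hA

lemma two_le_ncard_of_isVertexCut [Finite V] (hG : G.Connected) (h2 : ∀ w, ¬ HasParts G {w} 2)
    (h : IsVertexCut G X) : 2 ≤ X.ncard := by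
  by_contra! hlt
  have : X.ncard = 0 ∨ X.ncard = 1 := by omega
  rcases this with h0 | h1
  · rw [Set.ncard_eq_zero] at h0
    subst h0
    rw [isVertexCut_iff_hasParts] at h
    obtain ⟨A, B, ⟨a, ha⟩, ⟨b, hb⟩, -, hcov, hAB⟩ := exists_hasParts_two_sets h
    obtain ⟨c, hc, d, -, hd, hcd⟩ := (connOn_univ hG).exists_adj (Set.subset_univ A) ⟨a, ha⟩
      (Set.mem_univ b) (hAB.symm.1 b hb)
    exact hAB.2 c hc d ((hcov d (by simp)).resolve_left hd) hcd
  · obtain ⟨w, rfl⟩ := Set.ncard_eq_one.1 h1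
    exact h2 w (isVertexCut_iff_hasParts.1 h)

/-- A connected set with no edge to the rest of `G - X` is the vertex set of a component. -/
lemma image_supp_eq (hQ : ConnOn G Q) (hX : ∀ a ∈ Q, a ∉ X)
    (hcl : ∀ a ∈ Q, ∀ b ∉ X, G.Adj a b → b ∈ Q) (v : ↥(Xᶜ)) (hv : (v : V) ∈ Q) :
    Subtype.val '' ((deleteVerts G X).connectedComponentMk v).supp = Q := by
  ext w
  constructor
  · rintro ⟨w, hw, rfl⟩
    obtain ⟨p⟩ := (SimpleGraph.ConnectedComponent.exact hw).symm
    clear hw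
    induction p with
    | nil => exact hv
    | @cons a b c hab p ih => exact ih (hcl a hv b b.2 hab)
  · intro hw
    have := hQ {w | w ∈ Q ∧ ∃ hw : w ∉ X, (deleteVerts G X).Reachable v ⟨w, hw⟩}
      (fun w hw => hw.1) ⟨v, hv, v.2, SimpleGraph.Reachable.refl _⟩ (by
        rintro a ⟨ha, haX, hr⟩ b hb hab
        have : (deleteVerts G X).Adj ⟨a, haX⟩ ⟨b, hX b hb⟩ := hab
        exact ⟨hb, hX b hb, hr.trans this.reachable⟩) hw
    obtain ⟨-, hwX, hr⟩ := this
    exact ⟨⟨w, hwX⟩, SimpleGraph.ConnectedComponent.sound hr.symm, rfl⟩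

lemma componentsOfDelete_eq_pair (h₁ : Q₁.Nonempty) (h₂ : Q₂.Nonempty)
    (hX : ∀ v, v ∈ X → v ∉ Q₁ ∧ v ∉ Q₂) (hcov : ∀ v ∉ X, v ∈ Q₁ ∨ v ∈ Q₂)
    (ha : Anticomplete G Q₁ Q₂) (hc₁ : ConnOn G Q₁) (hc₂ : ConnOn G Q₂) :
    componentsOfDelete G X = {Q₁, Q₂} := by
  have e1 := fun v hv => image_supp_eq (X := X) hc₁ (fun a ha h => (hX a h).1 ha)
    (fun a haQ b hb hab => (hcov b hb).resolve_right fun h => ha.2 a haQ b h hab) v hv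
  have e2 := fun v hv => image_supp_eq (X := X) hc₂ (fun a ha h => (hX a h).2 ha)
    (fun a haQ b hb hab => (hcov b hb).resolve_left fun h => ha.2 b h a haQ hab.symm) v hv
  ext Q
  simp only [componentsOfDelete, Set.mem_ofPred_eq, Set.mem_insert_iff, Set.mem_singleton_iff]
  constructor
  · rintro ⟨C, rfl⟩
    induction C using SimpleGraph.ConnectedComponent.ind with
    | h v =>
      rcases hcov v v.2 with h | h
      · exact Or.inl (e1 v h)
      · exact Or.inr (e2 v h)
  · rintro (rfl | rfl)
    · obtain ⟨v, hv⟩ := h₁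
      exact ⟨_, (e1 ⟨v, fun h => (hX v h).1 hv⟩ hv).symm⟩
    · obtain ⟨v, hv⟩ := h₂
      exact ⟨_, (e2 ⟨v, fun h => (hX v h).2 hv⟩ hv).symm⟩

lemma of_componentsOfDelete_eq_pair (hne : Q₁ ≠ Q₂) (h : componentsOfDelete G X = {Q₁, Q₂}) :
    Q₁.Nonempty ∧ Q₂.Nonempty ∧ (∀ v ∈ X, v ∉ Q₁ ∧ v ∉ Q₂) ∧ (∀ v ∉ X, v ∈ Q₁ ∨ v ∈ Q₂) ∧
      Anticomplete G Q₁ Q₂ := by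
  obtain ⟨C₁, h₁⟩ : Q₁ ∈ componentsOfDelete G X := by rw [h]; simp
  obtain ⟨C₂, h₂⟩ : Q₂ ∈ componentsOfDelete G X := by rw [h]; simp
  have hC : C₁ ≠ C₂ := by
    rintro rfl
    exact hne (h₁.trans h₂.symm)
  refine ⟨?_, ?_, ?_, ?_, ?_, ?_⟩
  · rw [h₁]
    exact C₁.nonempty_supp.image _
  · rw [h₂]
    exact C₂.nonempty_supp.image _
  · intro v hv
    rw [h₁, h₂]
    constructor <;> rintro ⟨a, -, rfl⟩ <;> exact a.2 hv
  · intro v hv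
    have : Subtype.val '' ((deleteVerts G X).connectedComponentMk ⟨v, hv⟩).supp ∈
        componentsOfDelete G X := ⟨_, rfl⟩
    rw [h] at this
    have hm : v ∈ Subtype.val '' ((deleteVerts G X).connectedComponentMk ⟨v, hv⟩).supp :=
      ⟨⟨v, hv⟩, rfl, rfl⟩
    rcases this with h | h
    · exact Or.inl (h ▸ hm)
    · exact Or.inr (Set.mem_singleton_iff.1 h ▸ hm)
  · rw [h₁, h₂]
    rintro _ ⟨a, ha, rfl⟩ ⟨b, hb, hab⟩
    obtain rfl := Subtype.ext hab
    exact hC (ha.symm.trans hb)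
  · rw [h₁, h₂]
    rintro _ ⟨a, ha, rfl⟩ _ ⟨b, hb, rfl⟩ hab
    have hadj : (deleteVerts G X).Adj a b := hab
    exact hC (ha.symm.trans ((SimpleGraph.ConnectedComponent.sound hadj.reachable).trans hb))

/-! ### Consequences of a Hamiltonian path -/

/-- A path visits at most one component of `G - X` more than it has vertices in `X`. -/
lemma ncard_components_le [Finite V] [DecidablePred (· ∈ X)] {l : List V} (hl : l.IsChain G.Adj) :
    {C | ∃ v ∈ l, ∃ h : v ∉ X, C = (deleteVerts G X).connectedComponentMk ⟨v, h⟩}.ncard ≤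
      l.countP (· ∈ X) + (if ∃ v, l.head? = some v ∧ v ∉ X then 1 else 0) := by
  classical
  induction l with
  | nil => simp
  | cons a l ih =>
    have ih := ih hl.of_cons
    by_cases ha : a ∈ X
    · have e : {C | ∃ v ∈ a :: l, ∃ h : v ∉ X, C = (deleteVerts G X).connectedComponentMk ⟨v, h⟩} =
          {C | ∃ v ∈ l, ∃ h : v ∉ X, C = (deleteVerts G X).connectedComponentMk ⟨v, h⟩} := by
        ext C
        constructor
        · rintro ⟨v, hv, h, rfl⟩
          rcases List.mem_cons.1 hv with rfl | hv
          · exact absurd ha h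
          · exact ⟨v, hv, h, rfl⟩
        · rintro ⟨v, hv, h, rfl⟩
          exact ⟨v, List.mem_cons_of_mem _ hv, h, rfl⟩
      rw [e, List.countP_cons_of_pos (by simpa using ha)]
      split_ifs at ih <;> omega
    · have e : {C | ∃ v ∈ a :: l, ∃ h : v ∉ X, C = (deleteVerts G X).connectedComponentMk ⟨v, h⟩} =
          insert ((deleteVerts G X).connectedComponentMk ⟨a, ha⟩)
          {C | ∃ v ∈ l, ∃ h : v ∉ X, C = (deleteVerts G X).connectedComponentMk ⟨v, h⟩} := by
        ext C
        constructor
        · rintro ⟨v, hv, h, rfl⟩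
          rcases List.mem_cons.1 hv with rfl | hv
          · exact Or.inl rfl
          · exact Or.inr ⟨v, hv, h, rfl⟩
        · rintro (rfl | ⟨v, hv, h, rfl⟩)
          · exact ⟨a, List.mem_cons_self, ha, rfl⟩
          · exact ⟨v, List.mem_cons_of_mem _ hv, h, rfl⟩
      rw [e, List.countP_cons_of_neg (by simpa using ha), if_pos ⟨a, rfl, ha⟩]
      by_cases hb : ∃ v, l.head? = some v ∧ v ∉ X
      · obtain ⟨b, hb, hbX⟩ := hb
        rw [if_pos ⟨b, hb, hbX⟩] at ih
        rw [Set.insert_eq_of_mem]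
        · exact ih
        · cases l with
          | nil => simp at hb
          | cons c l =>
            simp only [List.head?_cons, Option.some.injEq] at hb
            subst hb
            refine ⟨c, List.mem_cons_self, hbX, ?_⟩
            have hadj : (deleteVerts G X).Adj ⟨a, ha⟩ ⟨c, hbX⟩ := (List.isChain_cons_cons.1 hl).1
            exact SimpleGraph.ConnectedComponent.sound hadj.reachable
      · rw [if_neg hb] at ih
        have := Set.ncard_insert_le ((deleteVerts G X).connectedComponentMk ⟨a, ha⟩)
          {C | ∃ v ∈ l, ∃ h : v ∉ X, C = (deleteVerts G X).connectedComponentMk ⟨v, h⟩}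
        omega

lemma numComponents_le_of_span [Finite V] (h : Span G Set.univ u v) :
    numComponents (deleteVerts G X) ≤ X.ncard + 1 := by
  classical
  obtain ⟨l, h1, h2, -, -, h5⟩ := h
  have := ncard_components_le (X := X) h1
  have e : {C | ∃ v ∈ l, ∃ h : v ∉ X, C = (deleteVerts G X).connectedComponentMk ⟨v, h⟩} =
      Set.univ := by
    ext C
    induction C using SimpleGraph.ConnectedComponent.ind with
    | h v => exact ⟨fun _ => trivial, fun _ => ⟨v, (h5 v).2 trivial, v.2, rfl⟩⟩
  rw [e, Set.ncard_univ] at this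
  have hcount : l.countP (· ∈ X) = X.ncard := by
    rw [List.countP_eq_length_filter, ← List.toFinset_card_of_nodup (h2.filter _),
      ← Set.ncard_coe_finset]
    congr 1
    ext x
    simp [h5]
  rw [hcount] at this
  unfold numComponents
  split_ifs at this <;> omega

lemma forall_mem_or_forall_mem {l : List V} (hl : l.IsChain G.Adj) (ha : Anticomplete G Q₁ Q₂)
    (h : ∀ v ∈ l, v ∈ Q₁ ∨ v ∈ Q₂) : (∀ v ∈ l, v ∈ Q₁) ∨ ∀ v ∈ l, v ∈ Q₂ := by
  induction l with
  | nil => simp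
  | cons a l ih =>
    have ih := ih hl.of_cons fun v hv => h v (List.mem_cons_of_mem _ hv)
    cases l with
    | nil => simpa using h a
    | cons b l =>
      have hab := (List.isChain_cons_cons.1 hl).1
      simp only [List.forall_mem_cons] at ih h ⊢
      have h1 := ha.2 a
      have h2 := ha.symm.2 a
      rcases ih with ⟨ih, ih'⟩ | ⟨ih, ih'⟩
      · exact Or.inl ⟨h.1.resolve_right fun h => h2 h b ih hab, ih, ih'⟩
      · exact Or.inr ⟨h.1.resolve_left fun h => h1 h b ih hab, ih, ih'⟩

/-- A cut vertex divides a Hamiltonian path into parts on either side. -/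
lemma sides_of_cutVertex {A B : List V} (hc : (A ++ x :: B).IsChain G.Adj)
    (hn : (A ++ x :: B).Nodup) (hall : ∀ v, v ∈ A ++ x :: B) (h₁ : Q₁.Nonempty) (h₂ : Q₂.Nonempty)
    (hx : x ∉ Q₁ ∧ x ∉ Q₂) (hcov : ∀ v, v ≠ x → v ∈ Q₁ ∨ v ∈ Q₂) (ha : Anticomplete G Q₁ Q₂) :
    ((∀ v ∈ A, v ∈ Q₁) ∧ ∀ v ∈ B, v ∈ Q₂) ∨ ((∀ v ∈ A, v ∈ Q₂) ∧ ∀ v ∈ B, v ∈ Q₁) := by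
  have hA : ∀ v ∈ A, v ≠ x := by
    rintro v hv rfl
    exact (List.nodup_append.1 hn).2.2 v hv v List.mem_cons_self rfl
  have hB : ∀ v ∈ B, v ≠ x := by
    rintro v hv rfl
    exact (List.nodup_cons.1 (List.nodup_append.1 hn).2.1).1 hv
  have hcase : ∀ v, v ≠ x → v ∈ A ∨ v ∈ B := by
    intro v hv
    have := hall v
    simp only [List.mem_append, List.mem_cons] at this
    tauto
  obtain ⟨q₁, hq₁⟩ := h₁
  obtain ⟨q₂, hq₂⟩ := h₂
  have k₁ := hcase q₁ fun e => hx.1 (e ▸ hq₁)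
  have k₂ := hcase q₂ fun e => hx.2 (e ▸ hq₂)
  rcases forall_mem_or_forall_mem hc.left_of_append ha fun v hv => hcov v (hA v hv) with hA' | hA' <;>
    rcases forall_mem_or_forall_mem hc.right_of_append.of_cons ha
      fun v hv => hcov v (hB v hv) with hB' | hB'
  · exact absurd hq₂ (k₂.elim (fun h => ha.1 q₂ (hA' _ h)) fun h => ha.1 q₂ (hB' _ h))
  · exact Or.inl ⟨hA', hB'⟩
  · exact Or.inr ⟨hA', hB'⟩
  · exact absurd (k₁.elim (hA' _) (hB' _)) (ha.1 q₁ hq₁)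

/-- No edge jumps over a cut vertex on a Hamiltonian path. -/
lemma not_adj_of_cutVertex {l : List V} (hc : l.IsChain G.Adj) (hn : l.Nodup) (hall : ∀ v, v ∈ l)
    {i j k : ℕ} (hi : i < l.length) (hj : j < l.length) (hk : k < l.length) (hij : i < j)
    (hjk : j < k) (hcut : HasParts G {l[j]} 2) : ¬ G.Adj l[i] l[k] := by
  have e : l = l.take j ++ l[j] :: l.drop (j + 1) := by simp
  obtain ⟨S, T, hS, hT, hX, hcov, hST⟩ := exists_hasParts_two_sets hcut
  have hmi : l[i] ∈ l.take j := List.mem_take_iff_getElem.2 ⟨i, by omega, rfl⟩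
  have hmk : l[k] ∈ l.drop (j + 1) :=
    List.mem_drop_iff_getElem.2 ⟨k - (j + 1), by omega, by congr 1; omega⟩
  rcases sides_of_cutVertex (A := l.take j) (x := l[j]) (B := l.drop (j + 1)) (by rwa [← e])
    (by rwa [← e]) (by rwa [← e]) hS hT (hX _ rfl) hcov hST with ⟨h1, h2⟩ | ⟨h1, h2⟩
  · exact hST.2 _ (h1 _ hmi) _ (h2 _ hmk)
  · exact fun h => hST.2 _ (h2 _ hmk) _ (h1 _ hmi) h.symm

lemma not_triangle_of_span (h : Span G Set.univ u v) :
    ∀ x y z, HasParts G {x} 2 → HasParts G {y} 2 → HasParts G {z} 2 →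
      G.Adj x y → G.Adj y z → ¬ G.Adj x z := by
  obtain ⟨l, hc, hn, -, -, hl⟩ := h
  have hall : ∀ v, v ∈ l := fun v => (hl v).2 trivial
  intro x y z hx hy hz hxy hyz hxz
  obtain ⟨i, hi, rfl⟩ := List.getElem_of_mem (hall x)
  obtain ⟨j, hj, rfl⟩ := List.getElem_of_mem (hall y)
  obtain ⟨k, hk, rfl⟩ := List.getElem_of_mem (hall z)
  have hij : i ≠ j := by rintro rfl; exact hxy.ne rfl
  have hjk : j ≠ k := by rintro rfl; exact hyz.ne rfl
  have hik : i ≠ k := by rintro rfl; exact hxz.ne rfl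
  have key := @not_adj_of_cutVertex V G l hc hn hall
  rcases lt_or_gt_of_ne hij with h1 | h1 <;> rcases lt_or_gt_of_ne hjk with h2 | h2 <;>
    rcases lt_or_gt_of_ne hik with h3 | h3
  · exact key hi hj hk h1 h2 hy hxz
  · omega
  · exact key hi hk hj h3 h2 hz hxy
  · exact key hk hi hj h3 h1 hx hyz.symm
  · exact key hj hi hk h1 h3 hx hyz
  · exact key hj hk hi h2 h3 hz hxy.symm
  · omega
  · exact key hk hj hi h2 h1 hy hxz.symm

/-- On either side of a cut vertex `x`, a Hamiltonian path leaves a Hamiltonian path starting in a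
neighbour of `x`. -/
lemma exists_span_side_of_span (h : Span G Set.univ u v) (h₁ : Q₁.Nonempty) (h₂ : Q₂.Nonempty)
    (hx : x ∉ Q₁ ∧ x ∉ Q₂) (hcov : ∀ v, v ≠ x → v ∈ Q₁ ∨ v ∈ Q₂) (ha : Anticomplete G Q₁ Q₂) :
    ∃ s ∈ Q₂, G.Adj x s ∧ ∃ t, Span G Q₂ s t := by
  have key : ∀ A B : List V, (A ++ x :: B).IsChain G.Adj → (A ++ x :: B).Nodup →
      (∀ v, v ∈ A ++ x :: B) → (∀ v ∈ A, v ∈ Q₁) → (∀ v ∈ B, v ∈ Q₂) →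
      ∃ s ∈ Q₂, G.Adj x s ∧ ∃ t, Span G Q₂ s t := by
    intro A B hc hn hall hA hB
    have hQ : ∀ v, v ∈ B ↔ v ∈ Q₂ := by
      refine fun v => ⟨hB v, fun hv => ?_⟩
      have := hall v
      simp only [List.mem_append, List.mem_cons] at this
      rcases this with h | rfl | h
      · exact absurd hv (ha.1 v (hA v h))
      · exact absurd hv hx.2
      · exact h
    cases B with
    | nil =>
      obtain ⟨q, hq⟩ := h₂
      simpa using (hQ q).2 hq
    | cons s B =>
      refine ⟨s, hB s List.mem_cons_self, (List.isChain_cons_cons.1 hc.right_of_append).1,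
        (s :: B).getLast (by simp), s :: B, hc.right_of_append.of_cons,
        (List.nodup_cons.1 (List.nodup_append.1 hn).2.1).2, rfl,
        List.getLast?_eq_some_getLast _, hQ⟩
  obtain ⟨l, hc, hn, -, -, hl⟩ := h
  have hall : ∀ v, v ∈ l := fun v => (hl v).2 trivial
  obtain ⟨A, B, rfl⟩ := List.append_of_mem (hall x)
  rcases sides_of_cutVertex hc hn hall h₁ h₂ hx hcov ha with ⟨hA, hB⟩ | ⟨hA, hB⟩
  · exact key A B hc hn hall hA hB
  · have e : B.reverse ++ x :: A.reverse = (A ++ x :: B).reverse := by simp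
    refine key B.reverse A.reverse ?_ ?_ ?_ (by simpa using hB) (by simpa using hA)
    · rw [e, List.isChain_reverse]
      exact hc.imp fun _ _ h => h.symm
    · rw [e, List.nodup_reverse]
      exact hn
    · rw [e]
      simpa only [List.mem_reverse] using hall

end

/-! ### The characterization -/

theorem theorem7 {V : Type*} [Fintype V] (G : SimpleGraph V)
    (hconn : G.Connected) (hfree : IsEdgelessFree 5 G) :
    HasHamiltonianPath G ↔
      -- (a)
      (∀ x : V, IsArticulationPoint G x → numComponents (deleteVerts G {x}) ≤ 2) ∧
      -- (b)
      (¬ ∃ x y z : V, IsArticulationPoint G x ∧ IsArticulationPoint G y ∧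
        IsArticulationPoint G z ∧ G.Adj x y ∧ G.Adj y z ∧ G.Adj x z) ∧
      -- (c)
      (¬ IsVertexConnected 2 G →
        ∀ (x : V) (Q₁ Q₂ : Set V), IsArticulationPoint G x →
          Q₁ ≠ Q₂ → componentsOfDelete G {x} = {Q₁, Q₂} →
          G.IsClique Q₁ → IsEdgelessFree 4 (G.induce Q₂) →
          ∃ u : Q₂, G.Adj x u ∧ HasHamiltonianPathFrom (G.induce Q₂) u) ∧
      -- (d)
      (IsVertexConnected 2 G → ¬ IsVertexConnected 3 G →
        ∀ x y : V, x ≠ y → IsMinimumVertexCut G {x, y} →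
          numComponents (deleteVerts G {x, y}) ≤ 3) := by
  rw [hasHamiltonianPath_iff]
  constructor
  · rintro ⟨u, v, h⟩
    refine ⟨fun x _ => ?_, ?_, ?_, fun _ _ x y hxy _ => ?_⟩
    · simpa using numComponents_le_of_span (X := {x}) h
    · rintro ⟨x, y, z, hx, hy, hz, hxy, hyz, hxz⟩
      exact not_triangle_of_span h x y z (isVertexCut_iff_hasParts.1 hx)
        (isVertexCut_iff_hasParts.1 hy) (isVertexCut_iff_hasParts.1 hz) hxy hyz hxz
    · intro _ x Q₁ Q₂ _ hne hcomp _ _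
      obtain ⟨h₁, h₂, hX, hcov, ha⟩ := of_componentsOfDelete_eq_pair hne hcomp
      obtain ⟨s, hs, hxs, ht⟩ := exists_span_side_of_span h h₁ h₂ (hX x rfl) hcov ha
      exact ⟨⟨s, hs⟩, hxs, hasHamiltonianPathFrom_induce_iff.2 ht⟩
    · have := numComponents_le_of_span (X := {x, y}) h
      rwa [Set.ncard_pair hxy] at this
  · rintro ⟨ha, hb, hc, hd⟩
    have hα : AlphaLE G Set.univ 4 := alphaLE_of_isEdgelessFree hfree
    have hG := connOn_univ hconn
    have := hconn.nonempty
    by_cases hcut : ∃ x, HasParts G {x} 2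
    · obtain ⟨x, hx⟩ := hcut
      have hx' : IsVertexCut G {x} := isVertexCut_iff_hasParts.2 hx
      refine exists_span_of_cutVertex hG hα ?_ ?_ hx ?_
      · intro w hw
        have h3 := hw.le_numComponents
        by_cases hwc : IsArticulationPoint G w
        · have := ha w hwc
          omega
        · -- `G - w` with three parts is disconnected.
          refine hwc fun hpre => ?_
          have : Subsingleton (deleteVerts G {w}).ConnectedComponent :=
            hpre.subsingleton_connectedComponent
          have := Finite.card_le_one_iff_subsingleton.2 this
          unfold numComponents at h3
          omega
      · intro x y z hx hy hz hxy hyz hxz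
        exact hb ⟨x, y, z, isVertexCut_iff_hasParts.2 hx, isVertexCut_iff_hasParts.2 hy,
          isVertexCut_iff_hasParts.2 hz, hxy, hyz, hxz⟩
      · intro Q₁ Q₂ h₁ h₂ hx₁ hx₂ hcov hanti hc₁ hc₂ hcl hα₂
        have hX : ∀ v, v ∈ ({x} : Set V) → v ∉ Q₁ ∧ v ∉ Q₂ := by
          rintro v rfl
          exact ⟨hx₁, hx₂⟩
        obtain ⟨u, hu, hp⟩ := hc (not_isVertexConnected hx' (by simp)) x Q₁ Q₂ hx'
          (by
            rintro rfl
            obtain ⟨q, hq⟩ := h₁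
            exact hanti.1 q hq hq)
          (componentsOfDelete_eq_pair h₁ h₂ hX (fun v hv => (hcov v).resolve_left hv) hanti hc₁ hc₂)
          hcl (isEdgelessFree_of_alphaLE hα₂)
        exact ⟨u, u.2, hu, hasHamiltonianPathFrom_induce_iff.1 hp⟩
    · push Not at hcut
      refine exists_span_of_no_cutVertex hG hα hcut fun x y hxy h4 => ?_
      have hle := h4.le_numComponents
      have hxc : IsVertexCut G {x, y} := by
        intro hpre
        have : Subsingleton (deleteVerts G {x, y}).ConnectedComponent :=
          hpre.subsingleton_connectedComponent
        have := Finite.card_le_one_iff_subsingleton.2 this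
        unfold numComponents at hle
        omega
      have hmin : ∀ A, IsVertexCut G A → 2 ≤ A.ncard :=
        fun A hA => two_le_ncard_of_isVertexCut hconn hcut hA
      have := hd (isVertexConnected_of_isVertexCut hxc hmin)
        (not_isVertexConnected hxc (by rw [Set.ncard_pair hxy]; omega)) x y hxy
        ⟨hxc, fun B hB => by rw [Set.ncard_pair hxy]; exact hmin B hB⟩
      omega
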